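/- Let $m\ge 0$ and $\Lambda\ge 0$, put $\Omega_L=(-\infty,-\Lambda)$, $\Omega_R=(\Lambda,\infty)$ and $\Omega=\Omega_L\cup\Omega_R$, and write $\psi=(\psi_\uparrow,\psi_\downarrow)$ for the elements of the Hilbert space $L^2(\Omega)\oplus L^2(\Omega)$ of complex-valued functions. Let $AC^1$ be the space of all $f\in L^2(\Omega)$ that are absolutely continuous up to the end point on each of the two half-lines $\Omega_L$, $\Omega_R$ (on every compact interval of its closure) and have $f'\in L^2(\Omega)$. For such $f$, let $f(-\Lambda)$ denote the end-point value of $f|_{\Omega_L}$ and $f(+\Lambda)$ the end-point value of $f|_{\Omega_R}$ (one-sided limits; for $\Lambda=0$ the two may differ). Let $AC^1_0=\{f\in AC^1: f(+\Lambda)=f(-\Lambda)=0\}$. The minimal Dirac operator $H_0$ has domain $AC^1_0\oplus AC^1_0$ and acts as $H_0=\sigma_x\otimes(-i\,d/dx)+m\,\sigma_z\otimes I$, that is, $$H_0(\psi_\uparrow,\psi_\downarrow)=(-i\psi_\downarrow'+m\psi_\uparrow,\;-i\psi_\uparrow'-m\psi_\downarrow).$$ Its adjoint $H_0^*$ is called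 the maximal Dirac operator (the elements of its domain have components in $AC^1$, so that $\psi(\pm\Lambda)=(\psi_\uparrow(\pm\Lambda),\psi_\downarrow(\pm\Lambda))\in\mathbb{C}^2$ makes sense). Theorem 1. (i) Let $\rho=(\rho_+,\rho_-)$ with $\rho_\pm\in\mathbb{R}\cup\{+\infty\}$, and let $D(H_\rho)$ be the space of all $\psi\in D(H_0^*)$ that satisfy $$i\rho_+\psi_\uparrow(+\Lambda)=\psi_\downarrow(+\Lambda)\ \text{ if }\rho_+\in\mathbb{R},\qquad \psi_\uparrow(+\Lambda)=0\ \text{ if }\rho_+=+\infty,$$ $$i\rho_-\psi_\uparrow(-\Lambda)=\psi_\downarrow(-\Lambda)\ \text{ if }\rho_-\in\mathbb{R},\qquad \psi_\uparrow(-\Lambda)=0\ \text{ if }\rho_-=+\infty.$$ Then the restriction $H_\rho$ of $H_0^*$ to $D(H_\rho)$ is a self-adjoint extension of $H_0$. (ii) Let $\alpha=(\alpha_1,\alpha_2,\alpha_3,\alpha_4)\in\mathbb{C}^4$ satisfy $$\mathrm{Re}(\alpha_1\alpha_2^*)=\mathrm{Re}(\alpha_1\alpha_3^*)=\mathrm{Re}(\alpha_2\alpha_4^*)=\mathrm{Re}(\alpha_3\alpha_4^*)=0,\qquad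 \alpha_1\alpha_4^*+\alpha_2\alpha_3^*=\alpha_1\alpha_4^*+\alpha_2^*\alpha_3=1,$$ where $^*$ is complex conjugation, and let $D(H_\alpha)$ be the space of all $\psi\in D(H_0^*)$ with $$\psi(+\Lambda)=B_\alpha\psi(-\Lambda),\qquad B_\alpha=\begin{pmatrix}\alpha_1&\alpha_2\\ \alpha_3&\alpha_4\end{pmatrix}.$$ Then the restriction $H_\alpha$ of $H_0^*$ to $D(H_\alpha)$ is a self-adjoint extension of $H_0$. -/

import Mathlib

open MeasureTheory Set
open scoped ComplexConjugate LinearPMap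

noncomputable section

namespace DiracJunction

/-- The left island `(-∞, -Λ)`. -/
def leftIsland (Λ : ℝ) : Set ℝ := Iio (-Λ)

/-- The right island `(Λ, ∞)`. -/
def rightIsland (Λ : ℝ) : Set ℝ := Ioi Λ

/-- The configuration space: the union of the two islands. -/
def configSpace (Λ : ℝ) : Set ℝ := leftIsland Λ ∪ rightIsland Λ

/-- `L²` of the configuration space, with Lebesgue measure. -/
abbrev L2 (Λ : ℝ) := Lp ℂ 2 (volume.restrict (configSpace Λ))

/-- The Hilbert space `L² ⊕ L²` of the wave functions `ψ = (ψ↑, ψ↓)`. -/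
abbrev Spinor (Λ : ℝ) := WithLp 2 (L2 Λ × L2 Λ)

/-- `f` is a representative of `u` on the island `I`, absolutely continuous on (every compact
interval in) the closure of `I`. -/
structure IsACRep (I : Set ℝ) (u f : ℝ → ℂ) : Prop where
  ac : ∀ a b : ℝ, uIcc a b ⊆ closure I → AbsolutelyContinuousOnInterval f a b
  ae_eq : u =ᵐ[volume.restrict I] f

/-- On the island `I`, the class of `u` has an absolutely continuous representative, whose almost
everywhere derivative is `v`. -/
def HasACDerivOn (I : Set ℝ) (u v : ℝ → ℂ) : Prop :=
  ∃ f : ℝ → ℂ, IsACRep I u f ∧ v =ᵐ[volume.restrict I] deriv f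

/-- The absolutely continuous representative of `u` on the closure of the island `I` takes the
value `c` at the point `x` (an end point of `I`). -/
def HasValueAt (I : Set ℝ) (u : ℝ → ℂ) (x : ℝ) (c : ℂ) : Prop :=
  ∃ f : ℝ → ℂ, IsACRep I u f ∧ f x = c

/-- `u` is absolutely continuous on the closure of each island, with derivative `v`. -/
def HasACDeriv (Λ : ℝ) (u v : L2 Λ) : Prop :=
  HasACDerivOn (leftIsland Λ) u v ∧ HasACDerivOn (rightIsland Λ) u v

section Helpers

theorem IsACRep.add {I : Set ℝ} {u₁ u₂ u f₁ f₂ : ℝ → ℂ} (h₁ : IsACRep I u₁ f₁)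
    (h₂ : IsACRep I u₂ f₂) (h : u =ᵐ[volume.restrict I] u₁ + u₂) : IsACRep I u (f₁ + f₂) :=
  ⟨fun a b hab => (h₁.ac a b hab).add (h₂.ac a b hab), h.trans (h₁.ae_eq.add h₂.ae_eq)⟩

theorem IsACRep.smul {I : Set ℝ} {u₁ u f₁ : ℝ → ℂ} (c : ℂ) (h₁ : IsACRep I u₁ f₁)
    (h : u =ᵐ[volume.restrict I] c • u₁) : IsACRep I u (c • f₁) :=
  ⟨fun a b hab => (h₁.ac a b hab).const_smul c, h.trans (h₁.ae_eq.const_smul c)⟩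

theorem IsACRep.zero {I : Set ℝ} {u : ℝ → ℂ} (h : u =ᵐ[volume.restrict I] 0) :
    IsACRep I u 0 := by
  refine ⟨fun a b _ => ?_, h⟩
  exact (LipschitzWith.const (0 : ℂ)).lipschitzOnWith.absolutelyContinuousOnInterval

theorem IsACRep.continuousOn {I : Set ℝ} (hIo : IsOpen I) {u f : ℝ → ℂ}
    (h : IsACRep I u f) : ContinuousOn f I := by
  intro x hx
  obtain ⟨ε, hε, hb⟩ := Metric.isOpen_iff.1 hIo x hx
  rw [Real.ball_eq_Ioo] at hb
  have hsub : uIcc (x - ε / 2) (x + ε / 2) ⊆ I := by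
    rw [uIcc_of_le (by linarith)]
    exact (Icc_subset_Ioo (by linarith) (by linarith)).trans hb
  have hc := (h.ac _ _ (hsub.trans subset_closure)).continuousOn
  rw [uIcc_of_le (by linarith)] at hc
  exact (hc.continuousAt (Icc_mem_nhds (by linarith) (by linarith))).continuousWithinAt

theorem IsACRep.ae_differentiableAt {I : Set ℝ} (hI : I.OrdConnected) (hIo : IsOpen I)
    {u f : ℝ → ℂ} (h : IsACRep I u f) :
    ∀ᵐ x ∂(volume.restrict I), DifferentiableAt ℝ f x := by
  have hbv : LocallyBoundedVariationOn f I := by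
    intro a b ha hb
    by_cases hab : a ≤ b
    · refine ((h.ac a b ?_).boundedVariationOn).mono ?_
      · exact (hI.uIcc_subset ha hb).trans subset_closure
      · rw [uIcc_of_le hab]
        exact inter_subset_right
    · rw [Icc_eq_empty hab, inter_empty]
      simp [BoundedVariationOn]
  rw [ae_restrict_iff' hIo.measurableSet]
  filter_upwards [hbv.ae_differentiableWithinAt_of_mem] with x hx hxI
  exact (hx hxI).differentiableAt (hIo.mem_nhds hxI)

theorem IsACRep.eqOn {I : Set ℝ} (hIo : IsOpen I) {u f g : ℝ → ℂ}
    (hf : IsACRep I u f) (hg : IsACRep I u g) : EqOn f g I :=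
  Measure.eqOn_open_of_ae_eq (hf.ae_eq.symm.trans hg.ae_eq) hIo
    (hf.continuousOn hIo) (hg.continuousOn hIo)

theorem HasACDerivOn.add {I : Set ℝ} (hI : I.OrdConnected) (hIo : IsOpen I)
    {u₁ u₂ u v₁ v₂ v : ℝ → ℂ} (h₁ : HasACDerivOn I u₁ v₁) (h₂ : HasACDerivOn I u₂ v₂)
    (hu : u =ᵐ[volume.restrict I] u₁ + u₂) (hv : v =ᵐ[volume.restrict I] v₁ + v₂) :
    HasACDerivOn I u v := by
  obtain ⟨f₁, hf₁, hd₁⟩ := h₁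
  obtain ⟨f₂, hf₂, hd₂⟩ := h₂
  refine ⟨f₁ + f₂, hf₁.add hf₂ hu, ?_⟩
  filter_upwards [hv, hd₁, hd₂, hf₁.ae_differentiableAt hI hIo, hf₂.ae_differentiableAt hI hIo]
    with x h0 h1 h2 h3 h4
  rw [h0, deriv_add h3 h4, Pi.add_apply, h1, h2]

theorem HasACDerivOn.smul {I : Set ℝ} (hI : I.OrdConnected) (hIo : IsOpen I) (c : ℂ)
    {u₁ u v₁ v : ℝ → ℂ} (h₁ : HasACDerivOn I u₁ v₁)
    (hu : u =ᵐ[volume.restrict I] c • u₁) (hv : v =ᵐ[volume.restrict I] c • v₁) :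
    HasACDerivOn I u v := by
  obtain ⟨f₁, hf₁, hd₁⟩ := h₁
  refine ⟨c • f₁, hf₁.smul c hu, ?_⟩
  filter_upwards [hv, hd₁, hf₁.ae_differentiableAt hI hIo] with x h0 h1 h3
  rw [h0, deriv_const_smul c h3, Pi.smul_apply, h1]

theorem HasACDerivOn.ae_unique {I : Set ℝ} (hIo : IsOpen I)
    {u v w : ℝ → ℂ} (h₁ : HasACDerivOn I u v) (h₂ : HasACDerivOn I u w) :
    v =ᵐ[volume.restrict I] w := by
  obtain ⟨f, hf, hdf⟩ := h₁
  obtain ⟨g, hg, hdg⟩ := h₂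
  have hfg := hf.eqOn hIo hg
  have hmem : ∀ᵐ x ∂(volume.restrict I), x ∈ I := ae_restrict_mem hIo.measurableSet
  filter_upwards [hdf, hdg, hmem] with x h1 h2 hx
  rw [h1, h2]
  exact (Filter.eventuallyEq_of_mem (hIo.mem_nhds hx) hfg).deriv_eq

theorem HasValueAt.add {I : Set ℝ} {u₁ u₂ u : ℝ → ℂ} {x : ℝ} {c₁ c₂ : ℂ}
    (h₁ : HasValueAt I u₁ x c₁) (h₂ : HasValueAt I u₂ x c₂)
    (h : u =ᵐ[volume.restrict I] u₁ + u₂) : HasValueAt I u x (c₁ + c₂) := by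
  obtain ⟨f₁, hf₁, rfl⟩ := h₁
  obtain ⟨f₂, hf₂, rfl⟩ := h₂
  exact ⟨f₁ + f₂, hf₁.add hf₂ h, rfl⟩

theorem HasValueAt.smul {I : Set ℝ} {u₁ u : ℝ → ℂ} {x : ℝ} {c₁ : ℂ} (c : ℂ)
    (h₁ : HasValueAt I u₁ x c₁) (h : u =ᵐ[volume.restrict I] c • u₁) :
    HasValueAt I u x (c * c₁) := by
  obtain ⟨f₁, hf₁, rfl⟩ := h₁
  exact ⟨c • f₁, hf₁.smul c h, rfl⟩

theorem HasValueAt.zero {I : Set ℝ} {u : ℝ → ℂ} {x : ℝ} (h : u =ᵐ[volume.restrict I] 0) :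
    HasValueAt I u x 0 := ⟨0, IsACRep.zero h, rfl⟩

theorem isOpen_leftIsland (Λ : ℝ) : IsOpen (leftIsland Λ) := isOpen_Iio

theorem isOpen_rightIsland (Λ : ℝ) : IsOpen (rightIsland Λ) := isOpen_Ioi

theorem ordConnected_leftIsland (Λ : ℝ) : (leftIsland Λ).OrdConnected := ordConnected_Iio

theorem ordConnected_rightIsland (Λ : ℝ) : (rightIsland Λ).OrdConnected := ordConnected_Ioi

theorem ae_left {Λ : ℝ} {u v : ℝ → ℂ} (h : u =ᵐ[volume.restrict (configSpace Λ)] v) :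
    u =ᵐ[volume.restrict (leftIsland Λ)] v :=
  ae_restrict_of_ae_restrict_of_subset subset_union_left h

theorem ae_right {Λ : ℝ} {u v : ℝ → ℂ} (h : u =ᵐ[volume.restrict (configSpace Λ)] v) :
    u =ᵐ[volume.restrict (rightIsland Λ)] v :=
  ae_restrict_of_ae_restrict_of_subset subset_union_right h

theorem HasACDeriv.add {Λ : ℝ} {u₁ u₂ v₁ v₂ : L2 Λ} (h₁ : HasACDeriv Λ u₁ v₁)
    (h₂ : HasACDeriv Λ u₂ v₂) : HasACDeriv Λ (u₁ + u₂) (v₁ + v₂) :=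
  ⟨h₁.1.add (ordConnected_leftIsland Λ) (isOpen_leftIsland Λ) h₂.1
      (ae_left (Lp.coeFn_add u₁ u₂)) (ae_left (Lp.coeFn_add v₁ v₂)),
    h₁.2.add (ordConnected_rightIsland Λ) (isOpen_rightIsland Λ) h₂.2
      (ae_right (Lp.coeFn_add u₁ u₂)) (ae_right (Lp.coeFn_add v₁ v₂))⟩

theorem HasACDeriv.smul {Λ : ℝ} (c : ℂ) {u v : L2 Λ} (h : HasACDeriv Λ u v) :
    HasACDeriv Λ (c • u) (c • v) :=
  ⟨h.1.smul (ordConnected_leftIsland Λ) (isOpen_leftIsland Λ) c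
      (ae_left (Lp.coeFn_smul c u)) (ae_left (Lp.coeFn_smul c v)),
    h.2.smul (ordConnected_rightIsland Λ) (isOpen_rightIsland Λ) c
      (ae_right (Lp.coeFn_smul c u)) (ae_right (Lp.coeFn_smul c v))⟩

theorem HasACDeriv.zero (Λ : ℝ) : HasACDeriv Λ 0 0 := by
  have h0 := Lp.coeFn_zero ℂ 2 (volume.restrict (configSpace Λ))
  have hd : deriv (0 : ℝ → ℂ) = 0 := by
    ext x
    simp
  refine ⟨⟨0, IsACRep.zero (ae_left h0), ?_⟩, ⟨0, IsACRep.zero (ae_right h0), ?_⟩⟩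
  · rw [hd]
    exact ae_left h0
  · rw [hd]
    exact ae_right h0

theorem HasACDeriv.unique {Λ : ℝ} {u v w : L2 Λ} (h₁ : HasACDeriv Λ u v)
    (h₂ : HasACDeriv Λ u w) : v = w := by
  apply Lp.ext
  exact (ae_restrict_union_iff _ _ _).2
    ⟨h₁.1.ae_unique (isOpen_leftIsland Λ) h₂.1,
      h₁.2.ae_unique (isOpen_rightIsland Λ) h₂.2⟩

end Helpers

/-- `AC¹`: the `L²` functions that are absolutely continuous on the closure of each island and have
their derivative in `L²`. -/
def AC1 (Λ : ℝ) : Submodule ℂ (L2 Λ) where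
  carrier := {u | ∃ v : L2 Λ, HasACDeriv Λ u v}
  add_mem' := by
    rintro _ _ ⟨v₁, h₁⟩ ⟨v₂, h₂⟩
    exact ⟨v₁ + v₂, h₁.add h₂⟩
  zero_mem' := ⟨0, HasACDeriv.zero Λ⟩
  smul_mem' := by
    rintro c _ ⟨v, h⟩
    exact ⟨c • v, h.smul c⟩

/-- The functions in `AC¹` that vanish on the boundary, i.e. at the end point of each island. -/
def AC1Zero (Λ : ℝ) : Submodule ℂ (L2 Λ) where
  carrier := {u | u ∈ AC1 Λ ∧ HasValueAt (leftIsland Λ) u (-Λ) 0 ∧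
    HasValueAt (rightIsland Λ) u Λ 0}
  add_mem' := by
    rintro u₁ u₂ ⟨h₁, l₁, r₁⟩ ⟨h₂, l₂, r₂⟩
    refine ⟨add_mem h₁ h₂, ?_, ?_⟩
    · simpa using l₁.add l₂ (ae_left (Lp.coeFn_add u₁ u₂))
    · simpa using r₁.add r₂ (ae_right (Lp.coeFn_add u₁ u₂))
  zero_mem' := ⟨zero_mem _,
    HasValueAt.zero (ae_left (Lp.coeFn_zero ℂ 2 (volume.restrict (configSpace Λ)))),
    HasValueAt.zero (ae_right (Lp.coeFn_zero ℂ 2 (volume.restrict (configSpace Λ))))⟩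
  smul_mem' := by
    rintro c u ⟨h, l, r⟩
    refine ⟨Submodule.smul_mem _ c h, ?_, ?_⟩
    · simpa using l.smul c (ae_left (Lp.coeFn_smul c u))
    · simpa using r.smul c (ae_right (Lp.coeFn_smul c u))

theorem AC1Zero_le_AC1 (Λ : ℝ) : AC1Zero Λ ≤ AC1 Λ := by
  rintro u ⟨h, _⟩
  exact h

/-- The derivative `d/dx : AC¹ → L²`. -/
def derivAC (Λ : ℝ) : AC1 Λ →ₗ[ℂ] L2 Λ where
  toFun u := u.2.choose
  map_add' u₁ u₂ := (u₁ + u₂).2.choose_spec.unique (u₁.2.choose_spec.add u₂.2.choose_spec)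
  map_smul' c u := (c • u).2.choose_spec.unique (u.2.choose_spec.smul c)

/-- The defining property of `derivAC`. -/
theorem hasACDeriv_derivAC (Λ : ℝ) (u : AC1 Λ) : HasACDeriv Λ u (derivAC Λ u) := u.2.choose_spec

/-- The momentum operator `p = -i d/dx` on the domain of the functions in `AC¹` that vanish on the
boundary. -/
def momentum (Λ : ℝ) : AC1Zero Λ →ₗ[ℂ] L2 Λ :=
  (-Complex.I) • (derivAC Λ).comp (Submodule.inclusion (AC1Zero_le_AC1 Λ))

/-- The domain of the minimal Dirac operator: both components lie in `AC1Zero`. -/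
def minimalDomain (Λ : ℝ) : Submodule ℂ (Spinor Λ) where
  carrier := {ψ | ψ.fst ∈ AC1Zero Λ ∧ ψ.snd ∈ AC1Zero Λ}
  add_mem' h₁ h₂ := ⟨add_mem h₁.1 h₂.1, add_mem h₁.2 h₂.2⟩
  zero_mem' := ⟨zero_mem (AC1Zero Λ), zero_mem (AC1Zero Λ)⟩
  smul_mem' c _ h := ⟨Submodule.smul_mem _ c h.1, Submodule.smul_mem _ c h.2⟩

/-- The minimal Dirac operator `H₀ = σ_x ⊗ p + m σ_z ⊗ I`, that is
`(ψ↑, ψ↓) ↦ (p ψ↓ + m ψ↑, p ψ↑ - m ψ↓)`. -/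
def minimalDirac (m Λ : ℝ) : Spinor Λ →ₗ.[ℂ] Spinor Λ where
  domain := minimalDomain Λ
  toFun :=
    { toFun := fun ψ => WithLp.toLp 2
        (momentum Λ ⟨ψ.1.snd, ψ.2.2⟩ + (m : ℂ) • ψ.1.fst,
          momentum Λ ⟨ψ.1.fst, ψ.2.1⟩ - (m : ℂ) • ψ.1.snd)
      map_add' := by
        intro ψ φ
        have h1 : (⟨(ψ + φ).1.fst, (ψ + φ).2.1⟩ : AC1Zero Λ) =
            ⟨ψ.1.fst, ψ.2.1⟩ + ⟨φ.1.fst, φ.2.1⟩ := rfl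
        have h2 : (⟨(ψ + φ).1.snd, (ψ + φ).2.2⟩ : AC1Zero Λ) =
            ⟨ψ.1.snd, ψ.2.2⟩ + ⟨φ.1.snd, φ.2.2⟩ := rfl
        rw [h1, h2, map_add, map_add, ← WithLp.toLp_add, Prod.mk_add_mk]
        congr 2
        · simp only [Submodule.coe_add, WithLp.add_fst, smul_add]
          abel
        · simp only [Submodule.coe_add, WithLp.add_snd, smul_add]
          abel
      map_smul' := by
        intro c ψ
        have h1 : (⟨(c • ψ).1.fst, (c • ψ).2.1⟩ : AC1Zero Λ) = c • ⟨ψ.1.fst, ψ.2.1⟩ := rfl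
        have h2 : (⟨(c • ψ).1.snd, (c • ψ).2.2⟩ : AC1Zero Λ) = c • ⟨ψ.1.snd, ψ.2.2⟩ := rfl
        rw [h1, h2, map_smul, map_smul, RingHom.id_apply, ← WithLp.toLp_smul, Prod.smul_mk]
        congr 2
        · simp only [Submodule.coe_smul, WithLp.smul_fst, smul_add, smul_comm c (m : ℂ)]
        · simp only [Submodule.coe_smul, WithLp.smul_snd, smul_sub, smul_comm c (m : ℂ)] }

/-- The maximal Dirac operator: the Hilbert space adjoint of the minimal one. -/
def maximalDirac (m Λ : ℝ) : Spinor Λ →ₗ.[ℂ] Spinor Λ := (minimalDirac m Λ)†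

/-- `ψ(+Λ) = vp` and `ψ(-Λ) = vm`, where the boundary value at `+Λ` is taken from the right island
and that at `-Λ` from the left island. Index `0` is the up-spin and `1` the down-spin component. -/
structure HasBoundaryValues (Λ : ℝ) (ψ : Spinor Λ) (vp vm : Fin 2 → ℂ) : Prop where
  up_right : HasValueAt (rightIsland Λ) ψ.fst Λ (vp 0)
  down_right : HasValueAt (rightIsland Λ) ψ.snd Λ (vp 1)
  up_left : HasValueAt (leftIsland Λ) ψ.fst (-Λ) (vm 0)
  down_left : HasValueAt (leftIsland Λ) ψ.snd (-Λ) (vm 1)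

/-- The wave functions whose pair of boundary values `(ψ(+Λ), ψ(-Λ))` exists and lies in `W`. -/
def boundarySubspace (Λ : ℝ) (W : Submodule ℂ ((Fin 2 → ℂ) × (Fin 2 → ℂ))) :
    Submodule ℂ (Spinor Λ) where
  carrier := {ψ | ∃ w ∈ W, HasBoundaryValues Λ ψ w.1 w.2}
  add_mem' := by
    rintro ψ φ ⟨w, hw, h⟩ ⟨z, hz, k⟩
    exact ⟨w + z, add_mem hw hz,
      h.1.add k.1 (ae_right (Lp.coeFn_add ψ.fst φ.fst)),
      h.2.add k.2 (ae_right (Lp.coeFn_add ψ.snd φ.snd)),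
      h.3.add k.3 (ae_left (Lp.coeFn_add ψ.fst φ.fst)),
      h.4.add k.4 (ae_left (Lp.coeFn_add ψ.snd φ.snd))⟩
  zero_mem' := by
    have h0 := Lp.coeFn_zero ℂ 2 (volume.restrict (configSpace Λ))
    exact ⟨0, zero_mem W, HasValueAt.zero (ae_right h0), HasValueAt.zero (ae_right h0),
      HasValueAt.zero (ae_left h0), HasValueAt.zero (ae_left h0)⟩
  smul_mem' := by
    rintro c ψ ⟨w, hw, h⟩
    exact ⟨c • w, Submodule.smul_mem W c hw,
      h.1.smul c (ae_right (Lp.coeFn_smul c ψ.fst)),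
      h.2.smul c (ae_right (Lp.coeFn_smul c ψ.snd)),
      h.3.smul c (ae_left (Lp.coeFn_smul c ψ.fst)),
      h.4.smul c (ae_left (Lp.coeFn_smul c ψ.snd))⟩

/-- The condition at one end point: `i r ψ↑ = ψ↓` if `r` is real, and `ψ↑ = 0` if `r = +∞`. -/
def EndCondition (r : WithTop ℝ) (v : Fin 2 → ℂ) : Prop :=
  (∀ s : ℝ, r = s → Complex.I * s * v 0 = v 1) ∧ (r = ⊤ → v 0 = 0)

/-- The pairs `(ψ(+Λ), ψ(-Λ))` that satisfy the separated boundary condition with parameters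
`ρ = (ρ₊, ρ₋)`. -/
def separatedCondition (ρ : WithTop ℝ × WithTop ℝ) :
    Submodule ℂ ((Fin 2 → ℂ) × (Fin 2 → ℂ)) where
  carrier := {w | EndCondition ρ.1 w.1 ∧ EndCondition ρ.2 w.2}
  add_mem' := by
    rintro w z ⟨⟨h1, h2⟩, h3, h4⟩ ⟨⟨k1, k2⟩, k3, k4⟩
    refine ⟨⟨fun s hs => ?_, fun h => ?_⟩, fun s hs => ?_, fun h => ?_⟩
    · simp only [Prod.fst_add, Pi.add_apply, mul_add, h1 s hs, k1 s hs]
    · simp [h2 h, k2 h]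
    · simp only [Prod.snd_add, Pi.add_apply, mul_add, h3 s hs, k3 s hs]
    · simp [h4 h, k4 h]
  zero_mem' := by simp [EndCondition]
  smul_mem' := by
    rintro c w ⟨⟨h1, h2⟩, h3, h4⟩
    refine ⟨⟨fun s hs => ?_, fun h => ?_⟩, fun s hs => ?_, fun h => ?_⟩
    · simp only [Prod.smul_fst, Pi.smul_apply, smul_eq_mul, mul_left_comm _ c, h1 s hs]
    · simp [h2 h]
    · simp only [Prod.smul_snd, Pi.smul_apply, smul_eq_mul, mul_left_comm _ c, h3 s hs]
    · simp [h4 h]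

/-- The class of the parameters `α = (α₁, α₂, α₃, α₄)`, here `(α 0, α 1, α 2, α 3)`. -/
structure AlphaClass (α : Fin 4 → ℂ) : Prop where
  re_12 : (α 0 * conj (α 1)).re = 0
  re_13 : (α 0 * conj (α 2)).re = 0
  re_24 : (α 1 * conj (α 3)).re = 0
  re_34 : (α 2 * conj (α 3)).re = 0
  sum_eq_one : α 0 * conj (α 3) + α 1 * conj (α 2) = 1
  sum_eq_one' : α 0 * conj (α 3) + conj (α 1) * α 2 = 1

/-- The boundary matrix `B_α`. -/
def boundaryMatrix (α : Fin 4 → ℂ) : Matrix (Fin 2) (Fin 2) ℂ :=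
  !![α 0, α 1; α 2, α 3]

/-- The pairs `(ψ(+Λ), ψ(-Λ))` with `ψ(+Λ) = B_α ψ(-Λ)`. -/
def transmissionCondition (α : Fin 4 → ℂ) : Submodule ℂ ((Fin 2 → ℂ) × (Fin 2 → ℂ)) where
  carrier := {w | w.1 = (boundaryMatrix α).mulVec w.2}
  add_mem' := by
    intro w z (h : w.1 = _) (k : z.1 = _)
    change w.1 + z.1 = (boundaryMatrix α).mulVec (w.2 + z.2)
    rw [h, k, Matrix.mulVec_add]
  zero_mem' := (Matrix.mulVec_zero (boundaryMatrix α)).symm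
  smul_mem' := by
    intro c w (h : w.1 = _)
    change c • w.1 = (boundaryMatrix α).mulVec (c • w.2)
    rw [h, Matrix.mulVec_smul]

/-- The Dirac operator `H_ρ`: the maximal Dirac operator restricted to the functions in its domain
that satisfy the separated boundary condition. -/
def diracSeparated (m Λ : ℝ) (ρ : WithTop ℝ × WithTop ℝ) : Spinor Λ →ₗ.[ℂ] Spinor Λ :=
  (maximalDirac m Λ).domRestrict (boundarySubspace Λ (separatedCondition ρ))

/-- The Dirac operator `H_α`: the maximal Dirac operator restricted to the functions in its domain
that satisfy `ψ(+Λ) = B_α ψ(-Λ)`. -/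
def diracTransmission (m Λ : ℝ) (α : Fin 4 → ℂ) : Spinor Λ →ₗ.[ℂ] Spinor Λ :=
  (maximalDirac m Λ).domRestrict (boundarySubspace Λ (transmissionCondition α))

end DiracJunction

end

noncomputable section

namespace DiracJunction

/-! ### Absolutely continuous complex functions -/

/-! Self-adjointness reduces to linear algebra on the boundary values in `ℂ² × ℂ²`. Integration by
parts on the two half-lines gives Green's formula (`IsDiracPair.inner_sub_inner`): for functions
with components in `AC1`, the failure of symmetry of the Dirac expression is `-i` times the
sesquilinear form `boundaryForm` of the boundary values. Nothing is contributed at infinity, and the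
mass term cancels because `m` is real.

Two analytic facts make this decisive. First, a function satisfying the adjoint relation against the
minimal domain has components in `AC1`, and the adjoint acts by the same differential expression
(`isDiracPair_of_inner`): testing against smooth compactly supported functions shows that the weak
derivatives lie in `L²`, and the du Bois-Reymond lemma turns a weak derivative into an absolutely
continuous representative. Second, every element of `ℂ² × ℂ²` occurs as the boundary value of such a
function (`exists_isDiracPair_boundaryValues`).

Hence restricting the maximal operator to boundary values in a subspace `W` gives an operator whose
adjoint is the restriction to the complement of `W` for the boundary form. It is self-adjoint when
`W` is its own complement (`IsLagrangian.isSelfAdjoint_domRestrict`). For the separated conditions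
this is checked at each end point. For the transmission conditions, the constraints on `α` say that
`B = boundaryMatrix α` satisfies `B* σ_x B = σ_x` and `B σ_x B* = σ_x`. -/

theorem absolutelyContinuousOnInterval_intervalIntegral_complex {f : ℝ → ℂ} {a b c : ℝ}
    (h : IntervalIntegrable f volume a b) (hc : c ∈ uIcc a b) :
    AbsolutelyContinuousOnInterval (fun x => ∫ t in c..x, f t) a b := by
  have hre : IntervalIntegrable (fun t => (f t).re) volume a b :=
    ⟨h.1.re, h.2.re⟩
  have him : IntervalIntegrable (fun t => (f t).im) volume a b :=
    ⟨h.1.im, h.2.im⟩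
  have hconst : ∀ z : ℂ, AbsolutelyContinuousOnInterval (fun _ : ℝ => z) a b := fun z =>
    (LipschitzWith.const z).lipschitzOnWith.absolutelyContinuousOnInterval
  -- The real and imaginary parts are handled separately and recombined with the constant functions
  -- `1` and `I`. The recombination equals the complex integral on `uIcc a b`, where integrability
  -- is known, so the ε-δ condition is transferred rather than the function rewritten.
  have key := ((hre.absolutelyContinuousOnInterval_intervalIntegral hc).fun_smul (hconst 1)).add
    ((him.absolutelyContinuousOnInterval_intervalIntegral hc).fun_smul (hconst Complex.I))
  refine (absolutelyContinuousOnInterval_iff _ _ _).2 fun ε hε => ?_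
  obtain ⟨δ, hδ, H⟩ := (absolutelyContinuousOnInterval_iff _ _ _).1 key ε hε
  refine ⟨δ, hδ, fun E hE hlt => ?_⟩
  refine lt_of_eq_of_lt (Finset.sum_congr rfl fun i hi => ?_) (H E hE hlt)
  have hval : ∀ x ∈ uIcc a b, ∫ t in c..x, f t =
      ((fun x => (∫ t in c..x, (f t).re) • (1 : ℂ)) +
        fun x => (∫ t in c..x, (f t).im) • Complex.I) x := by
    intro x hx
    have hi : IntervalIntegrable f volume c x :=
      h.mono_set (uIcc_subset_uIcc hc hx)
    have h1 : ∫ t in c..x, (f t).re = (∫ t in c..x, f t).re :=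
      intervalIntegral.intervalIntegral_re hi
    have h2 : ∫ t in c..x, (f t).im = (∫ t in c..x, f t).im :=
      intervalIntegral.intervalIntegral_im hi
    simp only [Pi.add_apply, Complex.real_smul, mul_one, h1, h2]
    exact (Complex.re_add_im _).symm
  rw [hval _ (hE.1 i hi).1, hval _ (hE.1 i hi).2]

/-- Subtracting the primitive of `v` from `f` leaves an absolutely continuous function with
derivative zero almost everywhere, hence a constant. -/
theorem integral_eq_sub_of_ae_hasDerivAt {f v : ℝ → ℂ} {a b : ℝ} (hab : a ≤ b)
    (hf : AbsolutelyContinuousOnInterval f a b) (hv : IntervalIntegrable v volume a b)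
    (h : ∀ᵐ x ∂(volume.restrict (Ioo a b)), HasDerivAt f (v x) x) :
    ∫ x in a..b, v x = f b - f a := by
  have hg := hf.sub (absolutelyContinuousOnInterval_intervalIntegral_complex hv left_mem_uIcc)
  obtain ⟨C, hC⟩ := hg.const_of_ae_hasDerivAt_zero (by
    rw [restrict_Ioo_eq_restrict_Icc, ae_restrict_iff' measurableSet_Icc] at h
    filter_upwards [h, hv.ae_hasDerivAt_integral] with x h1 h2 hx
    have := (h1 (by rwa [uIcc_of_le hab] at hx)).sub (h2 hx a left_mem_uIcc)
    rwa [sub_self] at this)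
  have h1 := hC a left_mem_uIcc
  have h2 := hC b right_mem_uIcc
  simp only [Pi.sub_apply, intervalIntegral.integral_same, sub_zero] at h1 h2
  rw [h1, ← h2]
  ring

/-- Integrability of the derivative makes `F` converge at infinity, and integrability of `F` itself
forces the limit to be zero, so only the end point contributes. -/
theorem integral_Ioi_of_absolutelyContinuous {F p : ℝ → ℂ} {a : ℝ}
    (hF : ∀ b, a ≤ b → AbsolutelyContinuousOnInterval F a b)
    (hd : ∀ᵐ x ∂(volume.restrict (Ioi a)), HasDerivAt F (p x) x)
    (hp : IntegrableOn p (Ioi a)) (hFi : IntegrableOn F (Ioi a)) :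
    ∫ x in Ioi a, p x = -F a := by
  have hlim := intervalIntegral_tendsto_integral_Ioi a hp Filter.tendsto_id
  have heq : ∀ b, a ≤ b → ∫ x in a..b, p x = F b - F a := fun b hb =>
    integral_eq_sub_of_ae_hasDerivAt hb (hF b hb)
      ((intervalIntegrable_iff_integrableOn_Ioc_of_le hb).2 (hp.mono_set Ioc_subset_Ioi_self))
      (ae_restrict_of_ae_restrict_of_subset Ioo_subset_Ioi_self hd)
  have hlim' : Filter.Tendsto F Filter.atTop (nhds ((∫ x in Ioi a, p x) + F a)) := by
    refine (hlim.add_const (F a)).congr' ?_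
    filter_upwards [Filter.eventually_ge_atTop a] with b hb
    rw [id, heq b hb, sub_add_cancel]
  have h0 := IntegrableAtFilter.eq_zero_of_tendsto (μ := volume)
    ⟨Ioi a, Filter.Ioi_mem_atTop a, hFi⟩ (fun s hs => by
      obtain ⟨b, hb⟩ := Filter.mem_atTop_sets.1 hs
      exact measure_mono_top (fun x hx => hb x hx) (Real.volume_Ici (a := b))) hlim'
  exact eq_neg_of_add_eq_zero_left h0

theorem integral_Iio_of_absolutelyContinuous {F p : ℝ → ℂ} {a : ℝ}
    (hF : ∀ b, b ≤ a → AbsolutelyContinuousOnInterval F b a)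
    (hd : ∀ᵐ x ∂(volume.restrict (Iio a)), HasDerivAt F (p x) x)
    (hp : IntegrableOn p (Iio a)) (hFi : IntegrableOn F (Iio a)) :
    ∫ x in Iio a, p x = F a := by
  have hp' : IntegrableOn p (Iic a) := by
    rwa [integrableOn_Iic_iff_integrableOn_Iio]
  have hlim := intervalIntegral_tendsto_integral_Iic a hp' Filter.tendsto_id
  have heq : ∀ b, b ≤ a → ∫ x in b..a, p x = F a - F b := fun b hb =>
    integral_eq_sub_of_ae_hasDerivAt hb (hF b hb)
      ((intervalIntegrable_iff_integrableOn_Ioc_of_le hb).2 (hp'.mono_set Ioc_subset_Iic_self))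
      (ae_restrict_of_ae_restrict_of_subset Ioo_subset_Iio_self hd)
  have hlim' : Filter.Tendsto F Filter.atBot (nhds (F a - ∫ x in Iic a, p x)) := by
    refine (hlim.const_sub (F a)).congr' ?_
    filter_upwards [Filter.eventually_le_atBot a] with b hb
    rw [id, heq b hb, sub_sub_cancel]
  have h0 := IntegrableAtFilter.eq_zero_of_tendsto (μ := volume)
    ⟨Iio a, Filter.Iio_mem_atBot a, hFi⟩ (fun s hs => by
      obtain ⟨b, hb⟩ := Filter.mem_atBot_sets.1 hs
      exact measure_mono_top (fun x hx => hb x hx) (Real.volume_Iic (a := b))) hlim'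
  rw [← integral_Iic_eq_integral_Iio]
  exact (sub_eq_zero.1 h0).symm

theorem absolutelyContinuousOnInterval_conj {f : ℝ → ℂ} {a b : ℝ}
    (hf : AbsolutelyContinuousOnInterval f a b) :
    AbsolutelyContinuousOnInterval (fun x => conj (f x)) a b := by
  refine (absolutelyContinuousOnInterval_iff _ _ _).2 fun ε hε => ?_
  obtain ⟨δ, hδ, H⟩ := (absolutelyContinuousOnInterval_iff _ _ _).1 hf ε hε
  refine ⟨δ, hδ, fun E hE hlt => ?_⟩
  simpa only [Complex.dist_conj_conj] using H E hE hlt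

/-- The representatives behind the boundary value and behind the derivative are chosen
independently. Uniqueness on the open set `I` lets one be used for both. -/
theorem IsACRep.ae_hasDerivAt {I : Set ℝ} (hI : I.OrdConnected) (hIo : IsOpen I)
    {u f v : ℝ → ℂ} (hf : IsACRep I u f) (hv : HasACDerivOn I u v) :
    ∀ᵐ x ∂(volume.restrict I), HasDerivAt f (v x) x := by
  have h : HasACDerivOn I u (deriv f) := ⟨f, hf, Filter.EventuallyEq.rfl⟩
  filter_upwards [hf.ae_differentiableAt hI hIo, h.ae_unique hIo hv] with x hx hvx
  rw [← hvx]
  exact hx.hasDerivAt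

theorem IsACRep.ae_hasDerivAt_conj_mul {I : Set ℝ} (hI : I.OrdConnected) (hIo : IsOpen I)
    {u₁ u₂ f₁ f₂ v₁ v₂ : ℝ → ℂ} (hf₁ : IsACRep I u₁ f₁) (hf₂ : IsACRep I u₂ f₂)
    (hv₁ : HasACDerivOn I u₁ v₁) (hv₂ : HasACDerivOn I u₂ v₂) :
    ∀ᵐ x ∂(volume.restrict I), HasDerivAt (fun y => conj (f₁ y) * f₂ y)
      (conj (u₁ x) * v₂ x + conj (v₁ x) * u₂ x) x := by
  filter_upwards [hf₁.ae_hasDerivAt hI hIo hv₁, hf₂.ae_hasDerivAt hI hIo hv₂, hf₁.ae_eq,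
    hf₂.ae_eq] with x h1 h2 h3 h4
  have h1' : HasDerivAt (fun y => conj (f₁ y)) (conj (v₁ x)) x := h1.star
  have := h1'.mul h2
  rw [h3, h4, add_comm]
  exact this

theorem integral_Ioi_conj_mul {a : ℝ} {u₁ u₂ f₁ f₂ v₁ v₂ : ℝ → ℂ} (hf₁ : IsACRep (Ioi a) u₁ f₁)
    (hf₂ : IsACRep (Ioi a) u₂ f₂) (hv₁ : HasACDerivOn (Ioi a) u₁ v₁)
    (hv₂ : HasACDerivOn (Ioi a) u₂ v₂)
    (hi : IntegrableOn (fun x => conj (u₁ x) * u₂ x) (Ioi a))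
    (hp : IntegrableOn (fun x => conj (u₁ x) * v₂ x + conj (v₁ x) * u₂ x) (Ioi a)) :
    ∫ x in Ioi a, (conj (u₁ x) * v₂ x + conj (v₁ x) * u₂ x) = -(conj (f₁ a) * f₂ a) := by
  refine integral_Ioi_of_absolutelyContinuous (F := fun y => conj (f₁ y) * f₂ y) (fun b hb => ?_)
    (hf₁.ae_hasDerivAt_conj_mul ordConnected_Ioi isOpen_Ioi hf₂ hv₁ hv₂) hp (hi.congr ?_)
  · have hs : uIcc a b ⊆ closure (Ioi a) := by
      rw [closure_Ioi, uIcc_of_le hb]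
      exact Icc_subset_Ici_self
    exact (absolutelyContinuousOnInterval_conj (hf₁.ac a b hs)).fun_smul (hf₂.ac a b hs)
  · filter_upwards [hf₁.ae_eq, hf₂.ae_eq] with x h1 h2
    rw [h1, h2]

theorem integral_Iio_conj_mul {a : ℝ} {u₁ u₂ f₁ f₂ v₁ v₂ : ℝ → ℂ} (hf₁ : IsACRep (Iio a) u₁ f₁)
    (hf₂ : IsACRep (Iio a) u₂ f₂) (hv₁ : HasACDerivOn (Iio a) u₁ v₁)
    (hv₂ : HasACDerivOn (Iio a) u₂ v₂)
    (hi : IntegrableOn (fun x => conj (u₁ x) * u₂ x) (Iio a))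
    (hp : IntegrableOn (fun x => conj (u₁ x) * v₂ x + conj (v₁ x) * u₂ x) (Iio a)) :
    ∫ x in Iio a, (conj (u₁ x) * v₂ x + conj (v₁ x) * u₂ x) = conj (f₁ a) * f₂ a := by
  refine integral_Iio_of_absolutelyContinuous (F := fun y => conj (f₁ y) * f₂ y) (fun b hb => ?_)
    (hf₁.ae_hasDerivAt_conj_mul ordConnected_Iio isOpen_Iio hf₂ hv₁ hv₂) hp (hi.congr ?_)
  · have hs : uIcc b a ⊆ closure (Iio a) := by
      rw [closure_Iio, uIcc_of_le hb]
      exact Icc_subset_Iic_self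
    exact (absolutelyContinuousOnInterval_conj (hf₁.ac b a hs)).fun_smul (hf₂.ac b a hs)
  · filter_upwards [hf₁.ae_eq, hf₂.ae_eq] with x h1 h2
    rw [h1, h2]

/-! ### Weak derivatives -/

/-- The smooth functions with compact support in `I`. -/
structure IsTestFunction (I : Set ℝ) (φ : ℝ → ℝ) : Prop where
  contDiff : ContDiff ℝ (⊤ : ℕ∞) φ
  hasCompactSupport : HasCompactSupport φ
  tsupport_subset : tsupport φ ⊆ I

/-- `w` is the distributional derivative of `u` on `I`. -/
def HasWeakDeriv (I : Set ℝ) (u w : ℝ → ℂ) : Prop :=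
  ∀ φ : ℝ → ℝ, IsTestFunction I φ →
    ∫ x in I, ((deriv φ x : ℝ) : ℂ) * u x = -∫ x in I, (φ x : ℂ) * w x

/-- Integrate from the left end of the support: zero mean makes the primitive vanish beyond the
right end. Its support lies in the convex hull of that of `φ`, which is why `I` must be
order-connected. -/
theorem IsTestFunction.exists_primitive {I : Set ℝ} (hI : I.OrdConnected) {φ : ℝ → ℝ}
    (hφ : IsTestFunction I φ) (h0 : ∫ x, φ x = 0) :
    ∃ ψ : ℝ → ℝ, IsTestFunction I ψ ∧ deriv ψ = φ := by
  rcases (tsupport φ).eq_empty_or_nonempty with he | hne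
  · refine ⟨φ, hφ, ?_⟩
    rw [tsupport_eq_empty_iff] at he
    subst he
    ext x
    simp
  have hc : IsCompact (tsupport φ) := hφ.hasCompactSupport
  obtain ⟨a, ha, hamin⟩ := hc.exists_isLeast hne
  obtain ⟨b, hb, hbmax⟩ := hc.exists_isGreatest hne
  have hsupp : ∀ x, φ x ≠ 0 → x ∈ Icc a b := fun x hx =>
    ⟨hamin (subset_tsupport φ hx), hbmax (subset_tsupport φ hx)⟩
  have hcont : Continuous φ := hφ.contDiff.continuous
  have hint : Integrable φ := hcont.integrable_of_hasCompactSupport hφ.hasCompactSupport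
  let ψ : ℝ → ℝ := fun x => ∫ t in a..x, φ t
  have hd : ∀ x, HasDerivAt ψ (φ x) x := fun x =>
    intervalIntegral.integral_hasDerivAt_right (hcont.intervalIntegrable _ _)
      (hcont.stronglyMeasurableAtFilter _ _) hcont.continuousAt
  have hderiv : deriv ψ = φ := funext fun x => (hd x).deriv
  have hφa : ∫ t in Iic a, φ t = 0 := by
    rw [integral_Iic_eq_integral_Iio]
    refine setIntegral_eq_zero_of_forall_eq_zero fun x hx => ?_
    by_contra hne
    exact absurd (hsupp x hne).1 (not_le.2 hx)
  have hout : ∀ x, x ∉ Icc a b → ψ x = 0 := by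
    intro x hx
    rcases lt_or_ge x a with hxa | hxa
    · refine intervalIntegral.integral_zero_ae ((Measure.ae_ne volume a).mono fun t hta ht => ?_)
      rw [uIoc_of_ge hxa.le] at ht
      by_contra hne
      exact hta (le_antisymm ht.2 (hsupp t hne).1)
    · have hbx : b < x := by
        by_contra hcon
        exact hx ⟨hxa, not_lt.1 hcon⟩
      have h1 : ∫ t in Iic x, φ t = ∫ t, φ t := by
        refine setIntegral_eq_integral_of_forall_compl_eq_zero fun t ht => ?_
        by_contra hne
        exact ht ((hsupp t hne).2.trans hbx.le)
      have h2 := intervalIntegral.integral_Iic_sub_Iic (f := φ) (μ := volume) (a := a) (b := x)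
        hint.integrableOn hint.integrableOn
      change ∫ t in a..x, φ t = 0
      rw [← h2, h1, h0, hφa, sub_zero]
  refine ⟨ψ, ⟨?_, HasCompactSupport.intro isCompact_Icc hout, ?_⟩, hderiv⟩
  · refine contDiff_infty_iff_deriv.2 ⟨fun x => (hd x).differentiableAt, ?_⟩
    rw [hderiv]
    exact hφ.contDiff
  · refine (closure_minimal (fun x hx => ?_) isClosed_Icc).trans
      (hI.out (hφ.tsupport_subset ha) (hφ.tsupport_subset hb))
    by_contra hcon
    exact hx (hout x hcon)

theorem IsTestFunction.add {I : Set ℝ} {φ ψ : ℝ → ℝ} (hφ : IsTestFunction I φ)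
    (hψ : IsTestFunction I ψ) : IsTestFunction I (φ + ψ) :=
  ⟨hφ.contDiff.add hψ.contDiff, hφ.hasCompactSupport.add hψ.hasCompactSupport,
    (tsupport_add φ ψ).trans (union_subset hφ.tsupport_subset hψ.tsupport_subset)⟩

theorem IsTestFunction.const_smul {I : Set ℝ} {φ : ℝ → ℝ} (c : ℝ) (hφ : IsTestFunction I φ) :
    IsTestFunction I (c • φ) :=
  ⟨contDiff_const.smul hφ.contDiff, hφ.hasCompactSupport.smul_left (f := fun _ => c),
    (tsupport_smul_subset_right (fun _ => c) φ).trans hφ.tsupport_subset⟩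

theorem exists_isTestFunction_integral_eq_one {I : Set ℝ} (hIo : IsOpen I) (hne : I.Nonempty) :
    ∃ η : ℝ → ℝ, IsTestFunction I η ∧ ∫ x, η x = 1 := by
  obtain ⟨c, hc⟩ := hne
  obtain ⟨ε, hε, hb⟩ := Metric.isOpen_iff.1 hIo c hc
  let b : ContDiffBump c := ⟨ε / 4, ε / 2, by positivity, by linarith⟩
  refine ⟨b.normed volume, ⟨b.contDiff_normed, b.hasCompactSupport_normed, ?_⟩, b.integral_normed⟩
  rw [b.tsupport_normed_eq]
  exact (Metric.closedBall_subset_ball (by change ε / 2 < ε; linarith)).trans hb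

theorem IsTestFunction.setIntegral_mul {I : Set ℝ} {φ : ℝ → ℝ} (hφ : IsTestFunction I φ)
    (u : ℝ → ℂ) : ∫ x in I, (φ x : ℂ) * u x = ∫ x, (φ x : ℂ) * u x := by
  refine setIntegral_eq_integral_of_forall_compl_eq_zero fun x hx => ?_
  rw [image_eq_zero_of_notMem_tsupport fun h => hx (hφ.tsupport_subset h)]
  simp

theorem IsTestFunction.isTestFunction_deriv {I : Set ℝ} {φ : ℝ → ℝ} (hφ : IsTestFunction I φ) :
    IsTestFunction I (deriv φ) :=
  ⟨(contDiff_infty_iff_deriv.1 hφ.contDiff).2, hφ.hasCompactSupport.deriv,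
    (tsupport_deriv_subset (f := φ)).trans hφ.tsupport_subset⟩

theorem IsTestFunction.integrable_mul {I : Set ℝ} {φ : ℝ → ℝ}
    (hφ : IsTestFunction I φ) {u : ℝ → ℂ} (hu : LocallyIntegrableOn u I) :
    Integrable (fun x => (φ x : ℂ) * u x) := by
  have hK : IntegrableOn u (tsupport φ) :=
    (hu.mono_set hφ.tsupport_subset).integrableOn_isCompact hφ.hasCompactSupport
  have h := hK.continuousOn_mul (g := fun x => (φ x : ℂ))
    (Complex.continuous_ofReal.comp hφ.contDiff.continuous).continuousOn hφ.hasCompactSupport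
  refine (integrableOn_iff_integrable_of_support_subset fun x hx => ?_).1 h
  refine subset_tsupport φ fun h0 => hx ?_
  simp [h0]

/-- The lemma of du Bois-Reymond. -/
theorem HasWeakDeriv.ae_eq_const {I : Set ℝ} (hI : I.OrdConnected) (hIo : IsOpen I)
    {u : ℝ → ℂ} (hu : LocallyIntegrableOn u I) (h : HasWeakDeriv I u 0) :
    ∃ c : ℂ, u =ᵐ[volume.restrict I] fun _ => c := by
  rcases I.eq_empty_or_nonempty with rfl | hne
  · exact ⟨0, by simp [Filter.EventuallyEq]⟩
  obtain ⟨η, hη, hη1⟩ := exists_isTestFunction_integral_eq_one hIo hne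
  -- As `η` has integral one, the average of `u` against `η` is the only possible constant.
  set c : ℂ := ∫ x, (η x : ℂ) * u x with hc
  refine ⟨c, ?_⟩
  have key := hIo.ae_eq_zero_of_integral_contDiff_smul_eq_zero (μ := volume)
    (f := fun x => u x - c) (hu.sub ((locallyIntegrable_const c).locallyIntegrableOn I)) ?_
  · rw [Filter.EventuallyEq, ae_restrict_iff' hIo.measurableSet]
    filter_upwards [key] with x hx hxI
    exact sub_eq_zero.1 (hx hxI)
  intro φ hφ1 hφ2 hφ3
  have hφ : IsTestFunction I φ := ⟨hφ1, hφ2, hφ3⟩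
  have hφi : Integrable φ := hφ1.continuous.integrable_of_hasCompactSupport hφ2
  have hηi : Integrable η := hη.contDiff.continuous.integrable_of_hasCompactSupport
    hη.hasCompactSupport
  -- Removing the multiple `(∫ φ) η` leaves mean zero, so the remainder is the derivative of a test
  -- function and is annihilated by `u`.
  have hχ := hφ.add (hη.const_smul (-∫ x, φ x))
  obtain ⟨ψ, hψ, hψd⟩ := hχ.exists_primitive hI (by
    simp only [Pi.add_apply, Pi.smul_apply, smul_eq_mul]
    rw [integral_add hφi (hηi.const_mul _), integral_const_mul, hη1]
    ring)
  have h0 := h ψ hψ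
  simp only [hψd, Pi.zero_apply, mul_zero, integral_zero, neg_zero] at h0
  rw [hχ.setIntegral_mul] at h0
  have hs : (fun x => (((φ + (-∫ x, φ x) • η) x : ℝ) : ℂ) * u x) =
      fun x => (φ x : ℂ) * u x - ((∫ x, φ x : ℝ) : ℂ) * ((η x : ℂ) * u x) := by
    ext x
    simp only [Pi.add_apply, Pi.smul_apply, smul_eq_mul]
    push_cast
    ring
  rw [hs, integral_sub (hφ.integrable_mul hu) ((hη.integrable_mul hu).const_mul _),
    integral_const_mul, ← hc] at h0
  have hs2 : (fun x => φ x • (u x - c)) = fun x => (φ x : ℂ) * u x - (φ x : ℂ) * c := by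
    ext x
    rw [Complex.real_smul]
    ring
  have hφc : Integrable fun x => (φ x : ℂ) := hφi.ofReal
  rw [hs2, integral_sub (hφ.integrable_mul hu) (hφc.mul_const c), integral_mul_const,
    ← h0, integral_complex_ofReal]

/-- Integrate the derivative of `φ F` over an interval `[-R, R]` whose interior contains the support
of `φ`; both end values vanish. -/
theorem integral_deriv_mul_eq_neg {φ : ℝ → ℝ} (hφ : ContDiff ℝ (⊤ : ℕ∞) φ)
    (hs : HasCompactSupport φ) {F w : ℝ → ℂ} (hw : LocallyIntegrable w)
    (hF : ∀ a b, AbsolutelyContinuousOnInterval F a b)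
    (hd : ∀ᵐ x, HasDerivAt F (w x) x) :
    ∫ x, ((deriv φ x : ℝ) : ℂ) * F x = -∫ x, (φ x : ℂ) * w x := by
  obtain ⟨R, hR0, hR⟩ := hs.isCompact.isBounded.exists_pos_norm_lt
  have hFc : Continuous F := continuous_iff_continuousAt.2 fun x =>
    (hF (x - 1) (x + 1)).continuousOn.continuousAt (by
      rw [uIcc_of_le (by linarith)]
      exact Icc_mem_nhds (by linarith) (by linarith))
  have hφu : IsTestFunction univ φ := ⟨hφ, hs, subset_univ _⟩
  have h1 : Integrable fun x => ((deriv φ x : ℝ) : ℂ) * F x :=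
    hφu.isTestFunction_deriv.integrable_mul (hFc.locallyIntegrable.locallyIntegrableOn _)
  have h2 : Integrable fun x => (φ x : ℂ) * w x :=
    hφu.integrable_mul (hw.locallyIntegrableOn _)
  have hout : ∀ x, x ∉ Ioo (-R) R → x ∉ tsupport φ := fun x hx hxs =>
    hx (abs_lt.1 (hR x hxs))
  have hz : ∀ x, x ∉ Ioo (-R) R → φ x = 0 := fun x hx =>
    image_eq_zero_of_notMem_tsupport (hout x hx)
  have hz' : ∀ x, x ∉ Ioo (-R) R → deriv φ x = 0 := fun x hx =>
    image_eq_zero_of_notMem_tsupport fun h => hout x hx (tsupport_deriv_subset h)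
  have hφac : AbsolutelyContinuousOnInterval φ (-R) R :=
    (hφ.of_le (by exact_mod_cast le_top)).contDiffOn.absolutelyContinuousOnInterval
  have hmain := integral_eq_sub_of_ae_hasDerivAt (f := fun x => φ x • F x)
    (v := fun x => ((deriv φ x : ℝ) : ℂ) * F x + (φ x : ℂ) * w x) (a := -R) (b := R) (by linarith)
    (hφac.fun_smul (hF _ _)) (h1.add h2).intervalIntegrable (by
      refine ae_restrict_of_ae (hd.mono fun x hx => ?_)
      have := ((hφ.differentiable (by simp)).differentiableAt (x := x)).hasDerivAt.smul hx
      rw [add_comm]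
      simp only [Complex.real_smul] at this
      exact this)
  rw [hz R (by simp), hz (-R) (by simp), zero_smul, zero_smul, sub_zero,
    intervalIntegral.integral_eq_integral_of_support_subset, integral_add h1 h2] at hmain
  · exact eq_neg_of_add_eq_zero_left hmain
  · intro x hx
    by_contra hcon
    have hx' : x ∉ Ioo (-R) R := fun h => hcon (Ioo_subset_Ioc_self h)
    exact hx (by simp [hz x hx', hz' x hx'])

/-- A primitive `F` of `w` has the same weak derivative as `u`, so they differ by a constant. Local
integrability of the indicator is assumed on all of `ℝ`, not merely on `I`: this gives absolute
continuity up to the end point. -/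
theorem HasWeakDeriv.hasACDerivOn {I : Set ℝ} (hI : I.OrdConnected) (hIo : IsOpen I)
    {u w : ℝ → ℂ} (hu : LocallyIntegrableOn u I) (hw : LocallyIntegrable (I.indicator w))
    (h : HasWeakDeriv I u w) : HasACDerivOn I u w := by
  let F : ℝ → ℂ := fun x => ∫ t in (0 : ℝ)..x, I.indicator w t
  have hFd : ∀ᵐ x, HasDerivAt F (I.indicator w x) x :=
    (LocallyIntegrable.ae_hasDerivAt_integral hw).mono fun x hx => hx 0
  have hFac : ∀ a b, AbsolutelyContinuousOnInterval F a b := fun a b => by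
    -- The base point `0` need not lie between `a` and `b`, so the interval is enlarged to contain
    -- it.
    refine (absolutelyContinuousOnInterval_intervalIntegral_complex (f := I.indicator w)
      (a := min 0 (min a b)) (b := max 0 (max a b)) (c := 0)
      (LocallyIntegrable.integrableOn_isCompact hw isCompact_uIcc).intervalIntegrable ?_).mono ?_
    · exact Icc_subset_uIcc ⟨min_le_left _ _, le_max_left _ _⟩
    · refine Subset.trans ?_ Icc_subset_uIcc
      exact Icc_subset_Icc (min_le_right _ _) (le_max_right _ _)
  have hFc : Continuous F := continuous_iff_continuousAt.2 fun x =>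
    (hFac (x - 1) (x + 1)).continuousOn.continuousAt (by
      rw [uIcc_of_le (by linarith)]
      exact Icc_mem_nhds (by linarith) (by linarith))
  have hFl : LocallyIntegrableOn F I := (hFc.locallyIntegrable.locallyIntegrableOn _)
  have hweak : HasWeakDeriv I (fun x => u x - F x) 0 := by
    refine fun φ hφ => ?_
    have h1 := h φ hφ
    have h2 := integral_deriv_mul_eq_neg hφ.contDiff hφ.hasCompactSupport hw hFac hFd
    have h3 : ∫ x, (φ x : ℂ) * I.indicator w x = ∫ x in I, (φ x : ℂ) * w x := by
      rw [← integral_indicator hIo.measurableSet]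
      refine integral_congr_ae (Filter.Eventually.of_forall fun x => ?_)
      by_cases hx : x ∈ I <;> simp [hx]
    have h4 := hφ.isTestFunction_deriv.setIntegral_mul F
    have hi1 := (hφ.isTestFunction_deriv.integrable_mul hu).integrableOn (s := I)
    have hi2 := (hφ.isTestFunction_deriv.integrable_mul hFl).integrableOn (s := I)
    simp only [mul_sub, Pi.zero_apply, mul_zero, integral_zero, neg_zero]
    rw [integral_sub hi1 hi2, h1, h4, h2, h3, sub_self]
  obtain ⟨c, hc⟩ := hweak.ae_eq_const hI hIo (hu.sub hFl)
  have hconst : ∀ a b : ℝ, AbsolutelyContinuousOnInterval (fun _ : ℝ => c) a b := fun a b =>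
    (LipschitzWith.const c).lipschitzOnWith.absolutelyContinuousOnInterval
  refine ⟨F + fun _ => c, ⟨fun a b _ => (hFac a b).add (hconst a b), ?_⟩, ?_⟩
  · filter_upwards [hc] with x hx
    rw [Pi.add_apply, ← hx, Pi.sub_apply, add_sub_cancel]
  · filter_upwards [ae_restrict_of_ae hFd, ae_restrict_mem hIo.measurableSet] with x hx hxI
    rw [indicator_of_mem hxI] at hx
    exact (hx.add_const c).deriv.symm

/-! ### Green's formula on the two islands -/

theorem disjoint_islands {Λ : ℝ} (hΛ : 0 ≤ Λ) : Disjoint (leftIsland Λ) (rightIsland Λ) := by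
  refine Set.disjoint_left.2 fun x hx hx' => ?_
  simp only [leftIsland, rightIsland, mem_Iio, mem_Ioi] at hx hx'
  linarith

theorem isOpen_configSpace (Λ : ℝ) : IsOpen (configSpace Λ) :=
  (isOpen_leftIsland Λ).union (isOpen_rightIsland Λ)

theorem setIntegral_configSpace {Λ : ℝ} (hΛ : 0 ≤ Λ) {f : ℝ → ℂ}
    (hf : IntegrableOn f (configSpace Λ)) :
    ∫ x in configSpace Λ, f x = (∫ x in leftIsland Λ, f x) + ∫ x in rightIsland Λ, f x :=
  setIntegral_union (disjoint_islands hΛ) (isOpen_rightIsland Λ).measurableSet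
    (hf.mono_set subset_union_left) (hf.mono_set subset_union_right)

theorem inner_eq_setIntegral {Λ : ℝ} (u v : L2 Λ) :
    inner ℂ u v = ∫ x in configSpace Λ, conj (u x) * v x := by
  rw [L2.inner_def]
  simp only [RCLike.inner_apply']

theorem integrableOn_conj_mul {Λ : ℝ} (u v : L2 Λ) :
    IntegrableOn (fun x => conj (u x) * v x) (configSpace Λ) := by
  have := L2.integrable_inner (𝕜 := ℂ) u v
  simp only [RCLike.inner_apply'] at this
  exact this

/-- The two signs differ because the end point is the upper limit of integration on the left island
and the lower one on the right. -/
theorem inner_add_inner_eq_boundary {Λ : ℝ} (hΛ : 0 ≤ Λ) {u₁ u₂ v₁ v₂ : L2 Λ} {l₁ l₂ r₁ r₂ : ℂ}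
    (h₁ : HasACDeriv Λ u₁ v₁) (h₂ : HasACDeriv Λ u₂ v₂)
    (hl₁ : HasValueAt (leftIsland Λ) u₁ (-Λ) l₁) (hl₂ : HasValueAt (leftIsland Λ) u₂ (-Λ) l₂)
    (hr₁ : HasValueAt (rightIsland Λ) u₁ Λ r₁) (hr₂ : HasValueAt (rightIsland Λ) u₂ Λ r₂) :
    inner ℂ u₁ v₂ + inner ℂ v₁ u₂ = conj l₁ * l₂ - conj r₁ * r₂ := by
  obtain ⟨f₁, hf₁, rfl⟩ := hl₁
  obtain ⟨f₂, hf₂, rfl⟩ := hl₂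
  obtain ⟨g₁, hg₁, rfl⟩ := hr₁
  obtain ⟨g₂, hg₂, rfl⟩ := hr₂
  have hi := integrableOn_conj_mul u₁ u₂
  have hp : IntegrableOn (fun x => conj (u₁ x) * v₂ x + conj (v₁ x) * u₂ x) (configSpace Λ) :=
    (integrableOn_conj_mul u₁ v₂).add (integrableOn_conj_mul v₁ u₂)
  rw [inner_eq_setIntegral, inner_eq_setIntegral,
    ← integral_add (integrableOn_conj_mul u₁ v₂) (integrableOn_conj_mul v₁ u₂),
    setIntegral_configSpace hΛ hp, leftIsland, rightIsland,
    integral_Iio_conj_mul hf₁ hf₂ h₁.1 h₂.1 (hi.mono_set subset_union_left)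
      (hp.mono_set subset_union_left),
    integral_Ioi_conj_mul hg₁ hg₂ h₁.2 h₂.2 (hi.mono_set subset_union_right)
      (hp.mono_set subset_union_right), sub_eq_add_neg]

theorem HasACDeriv.exists_left {Λ : ℝ} {u v : L2 Λ} (h : HasACDeriv Λ u v) :
    ∃ c, HasValueAt (leftIsland Λ) u (-Λ) c := by
  obtain ⟨⟨f, hf, -⟩, -⟩ := h
  exact ⟨_, f, hf, rfl⟩

theorem HasACDeriv.exists_right {Λ : ℝ} {u v : L2 Λ} (h : HasACDeriv Λ u v) :
    ∃ c, HasValueAt (rightIsland Λ) u Λ c := by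
  obtain ⟨-, f, hf, -⟩ := h
  exact ⟨_, f, hf, rfl⟩

/-! ### Functions with prescribed boundary values, and test functions -/

/-- The function equal to `φL` on the left and to `φR` on the right half-line. -/
def glue (φL φR : ℝ → ℂ) (x : ℝ) : ℂ := if 0 < x then φR x else φL x

theorem glue_ae_left {Λ : ℝ} (hΛ : 0 ≤ Λ) (φL φR : ℝ → ℂ) :
    glue φL φR =ᵐ[volume.restrict (leftIsland Λ)] φL := by
  filter_upwards [ae_restrict_mem (isOpen_leftIsland Λ).measurableSet] with x hx
  refine if_neg fun h => ?_
  simp only [leftIsland, mem_Iio] at hx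
  linarith

theorem glue_ae_right {Λ : ℝ} (hΛ : 0 ≤ Λ) (φL φR : ℝ → ℂ) :
    glue φL φR =ᵐ[volume.restrict (rightIsland Λ)] φR := by
  filter_upwards [ae_restrict_mem (isOpen_rightIsland Λ).measurableSet] with x hx
  exact if_pos (hΛ.trans_lt hx)

theorem memLp_glue {μ : Measure ℝ} [IsFiniteMeasureOnCompacts μ] {φL φR : ℝ → ℂ}
    (hL : Continuous φL) (hLs : HasCompactSupport φL)
    (hR : Continuous φR) (hRs : HasCompactSupport φR) : MemLp (glue φL φR) 2 μ := by
  have h1 : MemLp ((Ioi 0).indicator φR) 2 μ :=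
    (hR.memLp_of_hasCompactSupport hRs).indicator measurableSet_Ioi
  have h2 : MemLp ((Iic 0).indicator φL) 2 μ :=
    (hL.memLp_of_hasCompactSupport hLs).indicator measurableSet_Iic
  convert h1.add h2 using 1
  ext x
  by_cases hx : 0 < x
  · simp [glue, hx]
  · simp [glue, hx, not_lt.1 hx]

/-- Since `0 ≤ Λ`, the cut at `0` lies in neither island, so the two pieces need not match there,
even for `Λ = 0`. -/
theorem exists_hasACDeriv_glue {Λ : ℝ} (hΛ : 0 ≤ Λ) {φL φR : ℝ → ℂ}
    (hL : ContDiff ℝ 1 φL) (hLs : HasCompactSupport φL)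
    (hR : ContDiff ℝ 1 φR) (hRs : HasCompactSupport φR) :
    ∃ u v : L2 Λ, u =ᵐ[volume.restrict (configSpace Λ)] glue φL φR ∧
      v =ᵐ[volume.restrict (configSpace Λ)] glue (deriv φL) (deriv φR) ∧ HasACDeriv Λ u v ∧
      HasValueAt (leftIsland Λ) u (-Λ) (φL (-Λ)) ∧ HasValueAt (rightIsland Λ) u Λ (φR Λ) := by
  have hu : MemLp (glue φL φR) 2 (volume.restrict (configSpace Λ)) :=
    memLp_glue hL.continuous hLs hR.continuous hRs
  have hv : MemLp (glue (deriv φL) (deriv φR)) 2 (volume.restrict (configSpace Λ)) :=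
    memLp_glue (hL.continuous_deriv le_rfl) hLs.deriv (hR.continuous_deriv le_rfl) hRs.deriv
  have hLr : IsACRep (leftIsland Λ) (hu.toLp _) φL :=
    ⟨fun a b _ => hL.contDiffOn.absolutelyContinuousOnInterval,
      (ae_left hu.coeFn_toLp).trans (glue_ae_left hΛ _ _)⟩
  have hRr : IsACRep (rightIsland Λ) (hu.toLp _) φR :=
    ⟨fun a b _ => hR.contDiffOn.absolutelyContinuousOnInterval,
      (ae_right hu.coeFn_toLp).trans (glue_ae_right hΛ _ _)⟩
  exact ⟨hu.toLp _, hv.toLp _, hu.coeFn_toLp, hv.coeFn_toLp,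
    ⟨⟨φL, hLr, (ae_left hv.coeFn_toLp).trans (glue_ae_left hΛ _ _)⟩,
      ⟨φR, hRr, (ae_right hv.coeFn_toLp).trans (glue_ae_right hΛ _ _)⟩⟩,
    ⟨φL, hLr, rfl⟩, ⟨φR, hRr, rfl⟩⟩

theorem exists_contDiff_value_eq (x : ℝ) (c : ℂ) :
    ∃ φ : ℝ → ℂ, ContDiff ℝ 1 φ ∧ HasCompactSupport φ ∧ φ x = c := by
  let b : ContDiffBump x := ⟨1, 2, by norm_num, by norm_num⟩
  refine ⟨fun y => b y • c, b.contDiff.smul contDiff_const,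
    b.hasCompactSupport.smul_right (f' := fun _ => c), ?_⟩
  have : b x = 1 := b.one_of_mem_closedBall (by simp [b.rIn_pos.le])
  simp [this]

theorem exists_hasACDeriv_values {Λ : ℝ} (hΛ : 0 ≤ Λ) (l r : ℂ) :
    ∃ u v : L2 Λ, HasACDeriv Λ u v ∧ HasValueAt (leftIsland Λ) u (-Λ) l ∧
      HasValueAt (rightIsland Λ) u Λ r := by
  obtain ⟨φL, hL, hLs, rfl⟩ := exists_contDiff_value_eq (-Λ) l
  obtain ⟨φR, hR, hRs, rfl⟩ := exists_contDiff_value_eq Λ r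
  obtain ⟨u, v, -, -, h⟩ := exists_hasACDeriv_glue hΛ hL hLs hR hRs
  exact ⟨u, v, h⟩

/-- The support avoids both end points, so test functions lie in the minimal domain; being
real-valued, they turn inner products into the integrals of the weak formulation. -/
theorem IsTestFunction.exists_L2 {Λ : ℝ} (hΛ : 0 ≤ Λ) {φ : ℝ → ℝ}
    (hφ : IsTestFunction (configSpace Λ) φ) :
    ∃ u v : L2 Λ, HasACDeriv Λ u v ∧ u ∈ AC1Zero Λ ∧
      (∀ w : L2 Λ, inner ℂ u w = ∫ x in configSpace Λ, (φ x : ℂ) * w x) ∧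
      ∀ w : L2 Λ, inner ℂ v w = ∫ x in configSpace Λ, ((_root_.deriv φ x : ℝ) : ℂ) * w x := by
  have hc : ContDiff ℝ 1 fun x => (φ x : ℂ) :=
    Complex.ofRealCLM.contDiff.comp (hφ.contDiff.of_le (by exact_mod_cast le_top))
  have hs : HasCompactSupport fun x => (φ x : ℂ) :=
    hφ.hasCompactSupport.comp_left (g := fun t : ℝ => (t : ℂ)) Complex.ofReal_zero
  obtain ⟨u, v, hu, hv, h, hl, hr⟩ := exists_hasACDeriv_glue hΛ hc hs hc hs
  have hz : ∀ x, x ∉ configSpace Λ → φ x = 0 := fun x hx =>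
    image_eq_zero_of_notMem_tsupport fun h => hx (hφ.tsupport_subset h)
  have hl0 : φ (-Λ) = 0 := hz _ (by
    simp only [configSpace, leftIsland, rightIsland, mem_union, mem_Iio, mem_Ioi, not_or]
    constructor <;> linarith)
  have hr0 : φ Λ = 0 := hz _ (by
    simp only [configSpace, leftIsland, rightIsland, mem_union, mem_Iio, mem_Ioi, not_or]
    constructor <;> linarith)
  rw [hl0, Complex.ofReal_zero] at hl
  rw [hr0, Complex.ofReal_zero] at hr
  refine ⟨u, v, h, ⟨⟨v, h⟩, hl, hr⟩, fun w => ?_, fun w => ?_⟩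
  · rw [inner_eq_setIntegral]
    refine integral_congr_ae ?_
    filter_upwards [hu] with x hx
    simp [hx, glue]
  · rw [inner_eq_setIntegral]
    refine integral_congr_ae ?_
    filter_upwards [hv] with x hx
    have hd : _root_.deriv (fun x => (φ x : ℂ)) x = ((_root_.deriv φ x : ℝ) : ℂ) :=
      ((hφ.contDiff.differentiable (by simp)).differentiableAt (x := x)).hasDerivAt.ofReal_comp.deriv
    simp [hx, glue, hd]

/-! ### Weak derivatives and test-function density in `L²` -/

theorem locallyIntegrable_indicator_L2 {Λ : ℝ} {I : Set ℝ} (hIo : IsOpen I)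
    (hI : I ⊆ configSpace Λ) (u : L2 Λ) : LocallyIntegrable (I.indicator u) := by
  have h : MemLp (I.indicator u) 2 volume := by
    rw [memLp_indicator_iff_restrict hIo.measurableSet]
    exact (Lp.memLp u).mono_measure (Measure.restrict_mono hI le_rfl)
  exact h.locallyIntegrable (by norm_num)

theorem locallyIntegrableOn_L2 {Λ : ℝ} {I : Set ℝ} (hIo : IsOpen I)
    (hI : I ⊆ configSpace Λ) (u : L2 Λ) : LocallyIntegrableOn u I := by
  refine ((locallyIntegrable_indicator_L2 hIo hI u).locallyIntegrableOn I).congr ?_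
  filter_upwards [ae_restrict_mem hIo.measurableSet] with x hx
  exact indicator_of_mem hx _

theorem IsTestFunction.mono {I J : Set ℝ} (hIJ : I ⊆ J) {φ : ℝ → ℝ} (hφ : IsTestFunction I φ) :
    IsTestFunction J φ :=
  ⟨hφ.contDiff, hφ.hasCompactSupport, hφ.tsupport_subset.trans hIJ⟩

theorem HasWeakDeriv.mono {I J : Set ℝ} (hIJ : I ⊆ J) {u w : ℝ → ℂ} (h : HasWeakDeriv J u w) :
    HasWeakDeriv I u w := by
  refine fun φ hφ => ?_
  have h1 := h φ (hφ.mono hIJ)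
  rw [(hφ.mono hIJ).setIntegral_mul, (hφ.mono hIJ).isTestFunction_deriv.setIntegral_mul] at h1
  rw [hφ.setIntegral_mul, hφ.isTestFunction_deriv.setIntegral_mul, h1]

theorem HasWeakDeriv.hasACDeriv {Λ : ℝ} {u w : L2 Λ} (h : HasWeakDeriv (configSpace Λ) u w) :
    HasACDeriv Λ u w :=
  ⟨(h.mono subset_union_left).hasACDerivOn (ordConnected_leftIsland Λ) (isOpen_leftIsland Λ)
      (locallyIntegrableOn_L2 (isOpen_leftIsland Λ) subset_union_left u)
      (locallyIntegrable_indicator_L2 (isOpen_leftIsland Λ) subset_union_left w),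
    (h.mono subset_union_right).hasACDerivOn (ordConnected_rightIsland Λ) (isOpen_rightIsland Λ)
      (locallyIntegrableOn_L2 (isOpen_rightIsland Λ) subset_union_right u)
      (locallyIntegrable_indicator_L2 (isOpen_rightIsland Λ) subset_union_right w)⟩

theorem eq_zero_of_inner_AC1Zero {Λ : ℝ} (hΛ : 0 ≤ Λ) {w : L2 Λ}
    (h : ∀ u ∈ AC1Zero Λ, inner ℂ u w = 0) : w = 0 := by
  have key := (isOpen_configSpace Λ).ae_eq_zero_of_integral_contDiff_smul_eq_zero (μ := volume)
    (locallyIntegrableOn_L2 (isOpen_configSpace Λ) subset_rfl w) fun φ h1 h2 h3 => by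
      have hφ : IsTestFunction (configSpace Λ) φ := ⟨h1, h2, h3⟩
      obtain ⟨u, -, -, hu, hi, -⟩ := hφ.exists_L2 hΛ
      simp only [Complex.real_smul]
      rw [← hφ.setIntegral_mul, ← hi, h u hu]
  refine Lp.ext ?_
  refine Filter.EventuallyEq.trans ?_ (Lp.coeFn_zero ℂ 2 (volume.restrict (configSpace Λ))).symm
  exact (ae_restrict_iff' (isOpen_configSpace Λ).measurableSet).2 key

/-! ### The action of the Dirac operators -/

/-- `ψ` has components in `AC¹`, and `χ` is the image of `ψ` under the Dirac differential
expression. -/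
def IsDiracPair (m Λ : ℝ) (ψ χ : Spinor Λ) : Prop :=
  ∃ v w : L2 Λ, HasACDeriv Λ ψ.fst v ∧ HasACDeriv Λ ψ.snd w ∧
    χ.fst = (-Complex.I) • w + (m : ℂ) • ψ.fst ∧ χ.snd = (-Complex.I) • v - (m : ℂ) • ψ.snd

/-- The boundary form of the Dirac operator. -/
def boundaryForm (w z : (Fin 2 → ℂ) × (Fin 2 → ℂ)) : ℂ :=
  conj (w.1 0) * z.1 1 + conj (w.1 1) * z.1 0 - (conj (w.2 0) * z.2 1 + conj (w.2 1) * z.2 0)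

theorem spinor_inner {Λ : ℝ} (ψ φ : Spinor Λ) :
    inner ℂ ψ φ = inner ℂ ψ.fst φ.fst + inner ℂ ψ.snd φ.snd :=
  WithLp.prod_inner_apply ψ φ

/-- Green's formula. As `σ_x` exchanges the components, integration by parts pairs the up component
of one function with the down component of the other. -/
theorem IsDiracPair.inner_sub_inner {m Λ : ℝ} (hΛ : 0 ≤ Λ) {ψ χ ψ' χ' : Spinor Λ}
    (h : IsDiracPair m Λ ψ χ) (h' : IsDiracPair m Λ ψ' χ') {w z : (Fin 2 → ℂ) × (Fin 2 → ℂ)}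
    (hw : HasBoundaryValues Λ ψ w.1 w.2) (hz : HasBoundaryValues Λ ψ' z.1 z.2) :
    inner ℂ χ ψ' - inner ℂ ψ χ' = -Complex.I * boundaryForm w z := by
  obtain ⟨v₁, v₂, h₁, h₂, e₁, e₂⟩ := h
  obtain ⟨v₁', v₂', h₁', h₂', e₁', e₂'⟩ := h'
  have g1 := inner_add_inner_eq_boundary hΛ h₁ h₂' hw.up_left hz.down_left hw.up_right
    hz.down_right
  have g2 := inner_add_inner_eq_boundary hΛ h₂ h₁' hw.down_left hz.up_left hw.down_right
    hz.up_right
  rw [spinor_inner, spinor_inner, e₁, e₂, e₁', e₂']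
  simp only [inner_add_left, inner_add_right, inner_sub_left, inner_sub_right, inner_smul_left,
    inner_smul_right, map_neg, Complex.conj_I, Complex.conj_ofReal, neg_neg, boundaryForm]
  linear_combination Complex.I * g1 + Complex.I * g2

theorem IsDiracPair.exists_boundaryValues {m Λ : ℝ} {ψ χ : Spinor Λ} (h : IsDiracPair m Λ ψ χ) :
    ∃ w : (Fin 2 → ℂ) × (Fin 2 → ℂ), HasBoundaryValues Λ ψ w.1 w.2 := by
  obtain ⟨v₁, v₂, h₁, h₂, -⟩ := h
  obtain ⟨a, ha⟩ := h₁.exists_right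
  obtain ⟨b, hb⟩ := h₂.exists_right
  obtain ⟨c, hc⟩ := h₁.exists_left
  obtain ⟨d, hd⟩ := h₂.exists_left
  exact ⟨(![a, b], ![c, d]), ha, hb, hc, hd⟩

theorem exists_isDiracPair_boundaryValues (m : ℝ) {Λ : ℝ} (hΛ : 0 ≤ Λ)
    (w : (Fin 2 → ℂ) × (Fin 2 → ℂ)) :
    ∃ ψ χ : Spinor Λ, IsDiracPair m Λ ψ χ ∧ HasBoundaryValues Λ ψ w.1 w.2 := by
  obtain ⟨u₁, v₁, h₁, l₁, r₁⟩ := exists_hasACDeriv_values hΛ (w.2 0) (w.1 0)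
  obtain ⟨u₂, v₂, h₂, l₂, r₂⟩ := exists_hasACDeriv_values hΛ (w.2 1) (w.1 1)
  exact ⟨WithLp.toLp 2 (u₁, u₂), WithLp.toLp 2 ((-Complex.I) • v₂ + (m : ℂ) • u₁,
    (-Complex.I) • v₁ - (m : ℂ) • u₂), ⟨v₁, v₂, h₁, h₂, rfl, rfl⟩, r₁, r₂, l₁, l₂⟩

/-! ### Density of the minimal domain and identification of the maximal operator -/

theorem dense_minimalDomain {Λ : ℝ} (hΛ : 0 ≤ Λ) : Dense (minimalDomain Λ : Set (Spinor Λ)) := by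
  rw [Submodule.dense_iff_topologicalClosure_eq_top, Submodule.topologicalClosure_eq_top_iff,
    Submodule.eq_bot_iff]
  intro ψ hψ
  rw [Submodule.mem_orthogonal] at hψ
  have h1 : ψ.fst = 0 := eq_zero_of_inner_AC1Zero hΛ fun u hu => by
    have := hψ (WithLp.toLp 2 (u, 0)) ⟨hu, zero_mem (AC1Zero Λ)⟩
    simpa [spinor_inner] using this
  have h2 : ψ.snd = 0 := eq_zero_of_inner_AC1Zero hΛ fun u hu => by
    have := hψ (WithLp.toLp 2 (0, u)) ⟨zero_mem (AC1Zero Λ), hu⟩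
    simpa [spinor_inner] using this
  exact WithLp.ofLp_injective 2 (Prod.ext h1 h2)

theorem isDiracPair_minimalDirac (m Λ : ℝ) (ψ : (minimalDirac m Λ).domain) :
    IsDiracPair m Λ ψ (minimalDirac m Λ ψ) :=
  ⟨_, _, hasACDeriv_derivAC Λ ⟨ψ.1.fst, AC1Zero_le_AC1 Λ ψ.2.1⟩,
    hasACDeriv_derivAC Λ ⟨ψ.1.snd, AC1Zero_le_AC1 Λ ψ.2.2⟩, rfl, rfl⟩

theorem IsDiracPair.unique {m Λ : ℝ} {ψ χ χ' : Spinor Λ} (h : IsDiracPair m Λ ψ χ)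
    (h' : IsDiracPair m Λ ψ χ') : χ = χ' := by
  obtain ⟨v₁, v₂, h₁, h₂, e₁, e₂⟩ := h
  obtain ⟨v₁', v₂', h₁', h₂', e₁', e₂'⟩ := h'
  rw [h₁.unique h₁'] at e₂
  rw [h₂.unique h₂'] at e₁
  exact WithLp.ofLp_injective 2 (Prod.ext (e₁.trans e₁'.symm) (e₂.trans e₂'.symm))

theorem hasBoundaryValues_minimalDomain {Λ : ℝ} {ψ : Spinor Λ} (hψ : ψ ∈ minimalDomain Λ) :
    HasBoundaryValues Λ ψ 0 0 :=
  ⟨hψ.1.2.2, hψ.2.2.2, hψ.1.2.1, hψ.2.2.1⟩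

theorem HasWeakDeriv.of_inner {Λ : ℝ} (hΛ : 0 ≤ Λ) {u w : L2 Λ}
    (h : ∀ f g : L2 Λ, f ∈ AC1Zero Λ → HasACDeriv Λ f g → inner ℂ g u = -inner ℂ f w) :
    HasWeakDeriv (configSpace Λ) u w := by
  refine fun φ hφ => ?_
  obtain ⟨f, g, hfg, hf, h1, h2⟩ := hφ.exists_L2 hΛ
  rw [← h1, ← h2]
  exact h f g hf hfg

/-- Regularity of the adjoint. Testing with `(0, f)` and `(f, 0)` separates the relation into one
weak-derivative equation for each component of `ψ`. -/
theorem isDiracPair_of_inner {m Λ : ℝ} (hΛ : 0 ≤ Λ) {ψ χ : Spinor Λ}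
    (h : ∀ φ : (minimalDirac m Λ).domain, inner ℂ (minimalDirac m Λ φ) ψ = inner ℂ (φ : Spinor Λ) χ) :
    IsDiracPair m Λ ψ χ := by
  have key : ∀ f₁ g₁ f₂ g₂ : L2 Λ, f₁ ∈ AC1Zero Λ → HasACDeriv Λ f₁ g₁ → f₂ ∈ AC1Zero Λ →
      HasACDeriv Λ f₂ g₂ →
      inner ℂ ((-Complex.I) • g₂ + (m : ℂ) • f₁) ψ.fst +
        inner ℂ ((-Complex.I) • g₁ - (m : ℂ) • f₂) ψ.snd =
      inner ℂ f₁ χ.fst + inner ℂ f₂ χ.snd := by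
    intro f₁ g₁ f₂ g₂ h₁ d₁ h₂ d₂
    have hp : IsDiracPair m Λ (WithLp.toLp 2 (f₁, f₂)) (WithLp.toLp 2
        ((-Complex.I) • g₂ + (m : ℂ) • f₁, (-Complex.I) • g₁ - (m : ℂ) • f₂)) :=
      ⟨g₁, g₂, d₁, d₂, rfl, rfl⟩
    have h0 := h ⟨WithLp.toLp 2 (f₁, f₂), h₁, h₂⟩
    rw [(isDiracPair_minimalDirac m Λ _).unique hp, spinor_inner, spinor_inner] at h0
    exact h0
  have hz : HasACDeriv Λ 0 0 := HasACDeriv.zero Λ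
  -- These candidates for `ψ↑'` and `ψ↓'` come from solving the Dirac expression `χ` for the
  -- derivatives.
  refine ⟨Complex.I • (χ.snd + (m : ℂ) • ψ.snd), Complex.I • (χ.fst - (m : ℂ) • ψ.fst),
    (HasWeakDeriv.of_inner hΛ fun f g hf hfg => ?_).hasACDeriv,
    (HasWeakDeriv.of_inner hΛ fun f g hf hfg => ?_).hasACDeriv, ?_, ?_⟩
  · have := key 0 0 f g (zero_mem _) hz hf hfg
    simp only [smul_zero, add_zero, zero_sub, inner_neg_left, inner_smul_left, inner_zero_left,
      zero_add, map_neg, Complex.conj_I, Complex.conj_ofReal, neg_neg] at this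
    simp only [inner_smul_right, inner_add_right]
    linear_combination (-Complex.I) * this + inner ℂ g ψ.fst * Complex.I_mul_I
  · have := key f g 0 0 hf hfg (zero_mem _) hz
    simp only [smul_zero, add_zero, sub_zero, inner_smul_left, inner_zero_left,
      zero_add, map_neg, Complex.conj_I, Complex.conj_ofReal, neg_neg] at this
    simp only [inner_smul_right, inner_sub_right]
    linear_combination (-Complex.I) * this + inner ℂ g ψ.snd * Complex.I_mul_I
  · rw [smul_smul, neg_mul, Complex.I_mul_I, neg_neg, one_smul, sub_add_cancel]
  · rw [smul_smul, neg_mul, Complex.I_mul_I, neg_neg, one_smul, add_sub_cancel_right]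

theorem IsDiracPair.inner_minimalDirac {m Λ : ℝ} (hΛ : 0 ≤ Λ) {ψ χ : Spinor Λ}
    (h : IsDiracPair m Λ ψ χ) (φ : (minimalDirac m Λ).domain) :
    inner ℂ χ (φ : Spinor Λ) = inner ℂ ψ (minimalDirac m Λ φ) := by
  obtain ⟨w, hw⟩ := h.exists_boundaryValues
  have := h.inner_sub_inner hΛ (isDiracPair_minimalDirac m Λ φ) (z := 0) hw
    (hasBoundaryValues_minimalDomain φ.2)
  simpa [boundaryForm, sub_eq_zero] using this

theorem isDiracPair_maximalDirac {m Λ : ℝ} (hΛ : 0 ≤ Λ) (ψ : (maximalDirac m Λ).domain) :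
    IsDiracPair m Λ ψ (maximalDirac m Λ ψ) :=
  isDiracPair_of_inner hΛ fun φ =>
    (LinearPMap.adjoint_isFormalAdjoint (T := minimalDirac m Λ) (dense_minimalDomain hΛ)).symm φ ψ

theorem IsDiracPair.mem_maximalDomain {m Λ : ℝ} (hΛ : 0 ≤ Λ) {ψ χ : Spinor Λ}
    (h : IsDiracPair m Λ ψ χ) : ψ ∈ (maximalDirac m Λ).domain :=
  LinearPMap.mem_adjoint_domain_of_exists (T := minimalDirac m Λ) ψ
    ⟨χ, h.inner_minimalDirac hΛ⟩

/-! ### Self-adjoint boundary conditions -/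

/-- `W` is its own orthogonal complement with respect to the boundary form. -/
structure IsLagrangian (W : Submodule ℂ ((Fin 2 → ℂ) × (Fin 2 → ℂ))) : Prop where
  isotropic : ∀ w ∈ W, ∀ z ∈ W, boundaryForm w z = 0
  maximal : ∀ w, (∀ z ∈ W, boundaryForm w z = 0) → w ∈ W

theorem isDiracPair_domRestrict {m Λ : ℝ} (hΛ : 0 ≤ Λ)
    (W : Submodule ℂ ((Fin 2 → ℂ) × (Fin 2 → ℂ)))
    (ψ : ((maximalDirac m Λ).domRestrict (boundarySubspace Λ W)).domain) :
    IsDiracPair m Λ ψ ((maximalDirac m Λ).domRestrict (boundarySubspace Λ W) ψ) := by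
  have h : (maximalDirac m Λ).domRestrict (boundarySubspace Λ W) ψ =
      maximalDirac m Λ ⟨ψ, ψ.2.2⟩ := LinearPMap.domRestrict_apply rfl
  rw [h]
  exact isDiracPair_maximalDirac hΛ ⟨ψ, ψ.2.2⟩

theorem minimalDirac_le_domRestrict {m Λ : ℝ} (hΛ : 0 ≤ Λ)
    (W : Submodule ℂ ((Fin 2 → ℂ) × (Fin 2 → ℂ))) :
    minimalDirac m Λ ≤ (maximalDirac m Λ).domRestrict (boundarySubspace Λ W) := by
  refine ⟨fun ψ hψ => ⟨⟨0, zero_mem W, hasBoundaryValues_minimalDomain hψ⟩,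
    (isDiracPair_minimalDirac m Λ ⟨ψ, hψ⟩).mem_maximalDomain hΛ⟩, fun ψ φ h => ?_⟩
  have h1 := isDiracPair_minimalDirac m Λ ψ
  have h2 := isDiracPair_domRestrict hΛ W φ
  rw [← h] at h2
  exact h1.unique h2

/-- Isotropy of `W` makes `H` symmetric. Conversely, `H` extends the minimal operator, so elements
of the domain of `H†` are regular and have boundary values; maximality of `W` puts these in `W`. -/
theorem IsLagrangian.isSelfAdjoint_domRestrict {m Λ : ℝ} (hΛ : 0 ≤ Λ)
    {W : Submodule ℂ ((Fin 2 → ℂ) × (Fin 2 → ℂ))} (hW : IsLagrangian W) :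
    IsSelfAdjoint ((maximalDirac m Λ).domRestrict (boundarySubspace Λ W)) := by
  set H := (maximalDirac m Λ).domRestrict (boundarySubspace Λ W) with hH
  have hle : minimalDirac m Λ ≤ H := minimalDirac_le_domRestrict hΛ W
  have hdense : Dense (H.domain : Set (Spinor Λ)) := (dense_minimalDomain hΛ).mono hle.1
  rw [LinearPMap.isSelfAdjoint_def]
  have hsymm : H.IsFormalAdjoint H := by
    intro ψ φ
    obtain ⟨w, hw, hψ⟩ := ψ.2.1
    obtain ⟨z, hz, hφ⟩ := φ.2.1
    have := (isDiracPair_domRestrict hΛ W ψ).inner_sub_inner hΛ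
      (isDiracPair_domRestrict hΛ W φ) hψ hφ
    rw [hW.isotropic w hw z hz, mul_zero] at this
    exact sub_eq_zero.1 this
  have hadj := LinearPMap.adjoint_isFormalAdjoint hdense
  have hpair : ∀ ψ : H†.domain, IsDiracPair m Λ ψ (H† ψ) := fun ψ =>
    isDiracPair_of_inner hΛ fun φ => by
      rw [hle.2 (x := φ) (y := ⟨φ, hle.1 φ.2⟩) rfl]
      exact hadj.symm ⟨φ, hle.1 φ.2⟩ ψ
  have hge : H† ≤ H := by
    refine And.intro (fun ψ hψ => ?_) fun ψ φ h => ?_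
    · have hp := hpair ⟨ψ, hψ⟩
      obtain ⟨w, hw⟩ := hp.exists_boundaryValues
      refine ⟨⟨w, hW.maximal w fun z hz => ?_, hw⟩, hp.mem_maximalDomain hΛ⟩
      -- Each `z ∈ W` is realised by some `φ` in the domain of `H`; the adjoint relation with `φ`
      -- then makes the boundary form of `w` and `z` vanish.
      obtain ⟨φ, χ, hφχ, hφ⟩ := exists_isDiracPair_boundaryValues m hΛ z
      have hφH : φ ∈ H.domain := ⟨⟨z, hz, hφ⟩, hφχ.mem_maximalDomain hΛ⟩
      have h1 := hp.inner_sub_inner hΛ (isDiracPair_domRestrict hΛ W ⟨φ, hφH⟩) hw hφ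
      rw [sub_eq_zero.2 (hadj ⟨ψ, hψ⟩ ⟨φ, hφH⟩)] at h1
      simpa using h1.symm
    · have h1 := hpair ψ
      have h2 := isDiracPair_domRestrict hΛ W φ
      rw [← h] at h2
      exact h1.unique h2
  exact le_antisymm hge (hsymm.le_adjoint hdense)

/-! ### Linear algebra of the separated and transmission conditions -/

theorem endCondition_isotropic {r : WithTop ℝ} {v w : Fin 2 → ℂ} (hv : EndCondition r v)
    (hw : EndCondition r w) : conj (v 0) * w 1 + conj (v 1) * w 0 = 0 := by
  induction r using WithTop.recTopCoe with
  | top => simp [hv.2 rfl, hw.2 rfl]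
  | coe s =>
    rw [← hv.1 s rfl, ← hw.1 s rfl]
    simp only [map_mul, Complex.conj_I, Complex.conj_ofReal]
    ring

/-- The condition cuts out a line in `ℂ²`, so a spanning vector is enough as a test: `(0, 1)` for `r
= ⊤` and `(1, i s)` for `r = s`. -/
theorem endCondition_of_forall {r : WithTop ℝ} {v : Fin 2 → ℂ}
    (h : ∀ w, EndCondition r w → conj (v 0) * w 1 + conj (v 1) * w 0 = 0) : EndCondition r v := by
  induction r using WithTop.recTopCoe with
  | top =>
    have := h ![0, 1] ⟨fun s hs => absurd hs (WithTop.top_ne_coe), fun _ => rfl⟩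
    refine ⟨fun s hs => absurd hs (WithTop.top_ne_coe), fun _ => ?_⟩
    simpa using this
  | coe s =>
    have := h ![1, Complex.I * s] ⟨fun t ht => by simp [WithTop.coe_injective ht],
      fun ht => absurd ht WithTop.coe_ne_top⟩
    refine ⟨fun t ht => ?_, fun ht => absurd ht WithTop.coe_ne_top⟩
    obtain rfl := WithTop.coe_injective ht
    have h2 := congrArg conj this
    simp only [Matrix.cons_val_zero, Matrix.cons_val_one, map_add, map_mul, Complex.conj_conj,
      Complex.conj_I, Complex.conj_ofReal, map_zero, map_one] at h2
    linear_combination -h2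

theorem isLagrangian_separatedCondition (ρ : WithTop ℝ × WithTop ℝ) :
    IsLagrangian (separatedCondition ρ) := by
  have hz : ∀ r, EndCondition r 0 := fun r => ⟨fun s _ => by simp, fun _ => rfl⟩
  refine ⟨fun w hw z hz => ?_, fun w h => ⟨endCondition_of_forall fun v hv => ?_,
    endCondition_of_forall fun v hv => ?_⟩⟩
  · rw [boundaryForm, endCondition_isotropic hw.1 hz.1, endCondition_isotropic hw.2 hz.2, sub_zero]
  · simpa [boundaryForm] using h (v, 0) ⟨hv, hz _⟩
  · have := h (0, v) ⟨hz _, hv⟩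
    simp only [boundaryForm, Pi.zero_apply, mul_zero, add_zero, zero_sub, neg_eq_zero] at this
    exact this

theorem conj_mul_add_eq_zero {a b : ℂ} (h : (a * conj b).re = 0) :
    conj a * b + conj b * a = 0 := by
  have h1 : conj a * b + conj b * a = a * conj b + conj (a * conj b) := by
    rw [map_mul, Complex.conj_conj]
    ring
  rw [h1, Complex.add_conj, h]
  simp

/-- Isotropy of the graph of `B = boundaryMatrix α` is `B* σ_x B = σ_x`, which constrains the
columns (`re_13`, `re_24`, `sum_eq_one'`). Maximality uses `B σ_x B* = σ_x`, which constrains the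
rows (`re_12`, `re_34`, `sum_eq_one`). -/
theorem AlphaClass.isLagrangian {α : Fin 4 → ℂ} (hα : AlphaClass α) :
    IsLagrangian (transmissionCondition α) := by
  have h13 := conj_mul_add_eq_zero hα.re_13
  have h24 := conj_mul_add_eq_zero hα.re_24
  have h12 := conj_mul_add_eq_zero hα.re_12
  have h34 := conj_mul_add_eq_zero hα.re_34
  have hs := hα.sum_eq_one'
  have hs' := congrArg conj hs
  have ht := hα.sum_eq_one
  have ht' := congrArg conj ht
  simp only [map_add, map_mul, Complex.conj_conj, map_one] at hs' ht'
  have hmul : ∀ v : Fin 2 → ℂ, (boundaryMatrix α).mulVec v =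
      ![α 0 * v 0 + α 1 * v 1, α 2 * v 0 + α 3 * v 1] := by
    intro v
    ext i
    fin_cases i <;> simp [boundaryMatrix, Matrix.mulVec, dotProduct]
  refine ⟨fun w hw z hz => ?_, fun w h => ?_⟩
  · change w.1 = _ at hw
    change z.1 = _ at hz
    rw [hmul] at hw hz
    rw [boundaryForm, hw, hz]
    simp only [Matrix.cons_val_zero, Matrix.cons_val_one, map_add, map_mul]
    linear_combination conj (w.2 0) * z.2 0 * h13 + conj (w.2 1) * z.2 1 * h24 +
      conj (w.2 0) * z.2 1 * hs' + conj (w.2 1) * z.2 0 * hs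
  · change w.1 = _
    -- Testing over the two basis vectors yields `B* σ_x w₊ = σ_x w₋`, where `w = (w₊, w₋)`.
    -- Applying `B σ_x` then gives `w₊ = B w₋`.
    have k0 := congrArg conj (h ((boundaryMatrix α).mulVec ![1, 0], ![1, 0]) rfl)
    have k1 := congrArg conj (h ((boundaryMatrix α).mulVec ![0, 1], ![0, 1]) rfl)
    rw [hmul] at k0 k1 ⊢
    simp only [boundaryForm, Matrix.cons_val_zero, Matrix.cons_val_one, map_add, map_sub, map_mul,
      Complex.conj_conj, map_zero, mul_zero, mul_one, add_zero, zero_add] at k0 k1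
    ext i
    fin_cases i
    · change w.1 0 = α 0 * w.2 0 + α 1 * w.2 1
      linear_combination α 0 * k1 + α 1 * k0 - w.1 0 * ht - w.1 1 * h12
    · change w.1 1 = α 2 * w.2 0 + α 3 * w.2 1
      linear_combination α 2 * k1 + α 3 * k0 - w.1 0 * h34 - w.1 1 * ht'

end DiracJunction

end

theorem theorem1 (m Λ : ℝ) (hm : 0 ≤ m) (hΛ : 0 ≤ Λ) :
    (∀ ρ : WithTop ℝ × WithTop ℝ,
      DiracJunction.minimalDirac m Λ ≤ DiracJunction.diracSeparated m Λ ρ ∧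
        IsSelfAdjoint (DiracJunction.diracSeparated m Λ ρ)) ∧
    (∀ α : Fin 4 → ℂ, DiracJunction.AlphaClass α →
      DiracJunction.minimalDirac m Λ ≤ DiracJunction.diracTransmission m Λ α ∧
        IsSelfAdjoint (DiracJunction.diracTransmission m Λ α)) :=
  ⟨fun ρ => ⟨DiracJunction.minimalDirac_le_domRestrict hΛ _,
      (DiracJunction.isLagrangian_separatedCondition ρ).isSelfAdjoint_domRestrict hΛ⟩,
    fun _ hα => ⟨DiracJunction.minimalDirac_le_domRestrict hΛ _,
      hα.isLagrangian.isSelfAdjoint_domRestrict hΛ⟩⟩
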